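/- **Setting.** A single-server queue in discrete time has i.i.d. potential services $S^t$ with values in $\{0,1,\dots,S_{\max}\}$, mean $\mu>0$ and variance $\sigma_s^2$. For each $\epsilon\in(0,\mu)$ let $(X^t)^{(\epsilon)}_{t\ge 0}$ be an irreducible, aperiodic Markov chain on a finite set, with transition matrix $P_\epsilon$ and stationary distribution $\pi^{(\epsilon)}$. The arrivals are $(A^t)^{(\epsilon)}=f((X^t)^{(\epsilon)})$, where $f$ takes values in $\{0,1,\dots,A_{\max}\}$ (the finite set and $f$ may depend on $\epsilon$, the bound $A_{\max}$ may not), and the stationary arrival rate is $\lambda^{(\epsilon)}=E_{\pi^{(\epsilon)}}[f]=\mu-\epsilon$. The services are independent of the arrival chain and of the initial queue length, and the queue length, with values in $\{0,1,2,\dots\}$, evolves as $$Q^{t+1}=\max\{Q^t+A^t-S^t,0\}.$$ The chain $X$ is Markov with transition matrix $P_\epsilon$ also conditionally on the initial queue length, and the two-dimensional Markov chain $(Q^t,X^t)^{(\epsilon)}$ is irreducible and aperiodic (on its state space). The arrival chains mix geometrically, uniformly in $\epsilon$: there are $\alpha^{(\epsilon)}\in(0,1)$ and $C^{(\epsilon)}>0$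 with $$\max_x\|P_\epsilon^m(x,\cdot)-\pi^{(\epsilon)}\|_{TV}\le C^{(\epsilon)}(\alpha^{(\epsilon)})^m\quad (m\ge 1),\qquad \sup_\epsilon\alpha^{(\epsilon)}<1,\quad \sup_\epsilon C^{(\epsilon)}<\infty .$$ Let $\gamma^{(\epsilon)}(t)=E\big[((A^t)^{(\epsilon)}-\lambda^{(\epsilon)})((A^0)^{(\epsilon)}-\lambda^{(\epsilon)})\,\big|\,X^0\sim\pi^{(\epsilon)}\big]$ and assume that $\gamma(t)=\lim_{\epsilon\to0}\gamma^{(\epsilon)}(t)$ exists for every $t\in\{0,1,2,\dots\}$. **Theorem.** Let $\overline Q^{(\epsilon)}$ be a steady-state random variable to which the queue length process $(Q^t)^{(\epsilon)}$ converges in distribution as $t\to\infty$. Then the limit $$\sigma_a^2=\gamma(0)+2\lim_{m\to\infty}\sum_{t=1}^m\gamma(t)$$ exists and is nonnegative, and for every $\theta\le 0$ $$\lim_{\epsilon\to0}E\big[e^{\epsilon\theta\overline Q^{(\epsilon)}}\big]=\frac{1}{1-\theta\,\frac{\sigma_a^2+\sigma_s^2}{2}} .$$ Hence $\epsilon\overline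 Q^{(\epsilon)}$ converges in distribution, as $\epsilon\to0$, to an exponential random variable with mean $\frac{\sigma_a^2+\sigma_s^2}{2}$ (the constant $0$ if this mean is $0$). -/

import Mathlib

open MeasureTheory ProbabilityTheory Filter Topology

namespace HeavyTraffic

/-- The `n`-step transition law of the time-homogeneous Markov chain with one-step
transition law `K`: `nStep K n x y` is the probability to be in `y` after `n` steps from `x`. -/
noncomputable def nStep {E : Type*} (K : E → PMF E) : ℕ → E → PMF E
  | 0 => PMF.pure
  | n + 1 => fun x => (K x).bind (nStep K n)

/-- The chain with transition law `K` has `C` as a (nonempty, closed) state space, and is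
irreducible on it. -/
def IsIrreducibleOn {E : Type*} (K : E → PMF E) (C : Set E) : Prop :=
  C.Nonempty ∧ (∀ x ∈ C, (K x).support ⊆ C) ∧ ∀ x ∈ C, ∀ y ∈ C, ∃ n, nStep K n x y ≠ 0

/-- Every state of `C` has period one: the greatest common divisor of its possible return times
is `1`. -/
def IsAperiodicOn {E : Type*} (K : E → PMF E) (C : Set E) : Prop :=
  ∀ x ∈ C, ∀ d : ℕ, (∀ n : ℕ, 1 ≤ n → nStep K n x x ≠ 0 → d ∣ n) → d = 1

/-- `π` is a stationary distribution of the chain with transition law `K`. -/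
def IsStationary {E : Type*} (K : E → PMF E) (π : PMF E) : Prop :=
  π.bind K = π

/-- Total variation distance of two distributions on a finite set. -/
noncomputable def tvDist {E : Type*} [Fintype E] (p q : PMF E) : ℝ :=
  (1 / 2) * ∑ x, |(p x).toReal - (q x).toReal|

/-- Expectation of `f` under a distribution on a finite set. -/
noncomputable def expect {E : Type*} [Fintype E] (p : PMF E) (f : E → ℝ) : ℝ :=
  ∑ x, (p x).toReal * f x

/-- The autocovariance `E[(f(X^t) - λ)(f(X^0) - λ) | X^0 ∼ π]`, where `λ = E_π[f]`, of the Markov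
chain with transition law `P`. -/
noncomputable def autocov {E : Type*} [Fintype E] (P : E → PMF E) (π : PMF E) (f : E → ℕ)
    (t : ℕ) : ℝ :=
  expect π fun x =>
    ((f x : ℝ) - expect π fun z => (f z : ℝ)) *
      expect (nStep P t x) fun y => (f y : ℝ) - expect π fun z => (f z : ℝ)

/-- The queue length `max {q + a - s, 0}` after `a` arrivals and then a potential service `s`. -/
def nextQueue (q a s : ℕ) : ℕ :=
  (max ((q : ℤ) + a - s) 0).toNat

/-- One-step transition law of the two-dimensional chain `(Q^t, X^t)`: from `(q, x)`, draw a
service `s` from `νS` and, independently, the next state `y` from `P x`, and go to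
`(max {q + f x - s, 0}, y)`. -/
noncomputable def queueStep {E : Type*} (P : E → PMF E) (f : E → ℕ) (νS : PMF ℕ) :
    ℕ × E → PMF (ℕ × E) :=
  fun z => νS.bind fun s => (P z.2).bind fun y => PMF.pure (nextQueue z.1 (f z.2) s, y)

/-- A single-server queue in discrete time on a probability space `(Ω, Pr)`:
`X` is a Markov chain with transition law `P` (also conditionally on the initial queue length),
`A^t = f (X^t)` are the arrivals, the potential services `S^t` are i.i.d. with law `νS` and
independent of the arrivals and of the initial queue length, and the queue length obeys
`Q^{t+1} = max {Q^t + A^t - S^t, 0}`. -/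
structure IsMarkovModulatedQueue {Ω E : Type*} [MeasurableSpace Ω] [MeasurableSpace E]
    (Pr : Measure Ω) (P : E → PMF E) (f : E → ℕ) (νS : PMF ℕ)
    (X : ℕ → Ω → E) (S Q : ℕ → Ω → ℕ) : Prop where
  measurable_X : ∀ t, Measurable (X t)
  measurable_S : ∀ t, Measurable (S t)
  measurable_Q_zero : Measurable (Q 0)
  markov : ∀ (n q : ℕ) (x : ℕ → E),
    Pr {ω | Q 0 ω = q ∧ ∀ i ≤ n + 1, X i ω = x i} =
      Pr {ω | Q 0 ω = q ∧ ∀ i ≤ n, X i ω = x i} * P (x n) (x (n + 1))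
  law_S : ∀ t, Pr.map (S t) = νS.toMeasure
  iIndep_S : iIndepFun S Pr
  indep_arrivals_services :
    IndepFun (fun ω => (Q 0 ω, fun t => X t ω)) (fun ω t => S t ω) Pr
  recursion : ∀ t ω, Q (t + 1) ω = nextQueue (Q t ω) (f (X t ω)) (S t ω)

/-- The exponential distribution with mean `m`; for `m = 0` it is the point mass at `0`. -/
noncomputable def expLaw (m : ℝ) : Measure ℝ :=
  open Classical in if 0 < m then expMeasure (1 / m) else Measure.dirac 0

instance isProbabilityMeasure_expLaw (m : ℝ) : IsProbabilityMeasure (expLaw m) := by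
  unfold expLaw
  split_ifs with h
  · exact isProbabilityMeasure_expMeasure (one_div_pos.mpr h)
  · infer_instance

end HeavyTraffic

namespace HeavyTraffic

/-! The proof is a transform argument with a corrected exponential test function. For `s` with
nonpositive real part, take V(q, x) = exp(s q) (1 + s h(x) + s² k(x)). Here h solves the Poisson
equation of the modulating chain for f, and k solves it for ((f − μ)² + σ_s²)/2 + (f − μ) P h. With
these corrections the first two orders of the one-step drift no longer depend on x: the drift of V
is exp(s q) (−s ε + s² F) + s u up to an error of order |s|³ + |s|² u. Here u is the mean unused
service, and F is the stationary mean of the second-order term (`norm_drift_sub_le`). By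
`expect_quadratic_drift`, 2F is the autocovariance sum plus ε² + σ_s².

V is bounded, so its drift averages to zero over time, whereas the mean of exp(s Q^t) converges to
the transform ψ(s) of the steady state. Hence ψ(s) (−s ε + s² F) + s U is small, where U is a limit
of averaged unused service (`norm_timeAverage_le`). Letting s → 0 for fixed ε forces U = ε
(`unused_eq_of_transform_bound`). Neither a stationary law of the pair (Q, X) nor moments of the
queue are needed.

Putting s = ε z and dividing by ε² z gives ψ(ε z) (1 − z F) = 1 + O(ε)
(`tendsto_of_transform_bound`), with constants uniform in ε because mixing is uniform. Uniform
mixing also dominates the autocovariance series, so F tends to (σ_a² + σ_s²)/2. Real z gives the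
stated transform limit; imaginary z gives characteristic functions, hence convergence in
distribution. -/

/-- The initial queue length, the arrival states up to time `t` and the services before time `t`. -/
def history {Ω E : Type*} (X : ℕ → Ω → E) (S Q : ℕ → Ω → ℕ) (t : ℕ) (ω : Ω) :
    ℕ × (Fin (t + 1) → E) × (Fin t → ℕ) :=
  (Q 0 ω, fun i => X i ω, fun i => S i ω)

lemma history_eq_iff {Ω E : Type*} {X : ℕ → Ω → E} {S Q : ℕ → Ω → ℕ} {t : ℕ} {ω ω' : Ω} :
    history X S Q t ω = history X S Q t ω' ↔
      (Q 0 ω = Q 0 ω' ∧ ∀ i ≤ t, X i ω = X i ω') ∧ ∀ i < t, S i ω = S i ω' := by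
  simp only [history, Prod.mk.injEq, funext_iff, Fin.forall_iff, Nat.lt_succ_iff, and_assoc]

/-! ### One-step law of the queue along its history -/

section Markov

variable {Ω E : Type*} [MeasurableSpace Ω] [MeasurableSpace E]
  {Pr : Measure Ω} {P : E → PMF E} {f : E → ℕ} {νS : PMF ℕ}
  {X : ℕ → Ω → E} {S Q : ℕ → Ω → ℕ}

namespace IsMarkovModulatedQueue

variable (hq : IsMarkovModulatedQueue Pr P f νS X S Q)

include hq

/-- This lets functions of the current state factor through the history. -/
lemma queue_eq_of_history_eq {t : ℕ} {ω ω' : Ω}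
    (h : history X S Q t ω = history X S Q t ω') : Q t ω = Q t ω' := by
  rw [history_eq_iff] at h
  obtain ⟨⟨h0, hX⟩, hS⟩ := h
  have : ∀ s ≤ t, Q s ω = Q s ω' := by
    intro s
    induction s with
    | zero => exact fun _ => h0
    | succ s ih =>
      intro hs
      rw [hq.recursion, hq.recursion, ih (by omega), hX s (by omega), hS s (by omega)]
  exact this t le_rfl

lemma measurable_history (t : ℕ) : Measurable (history X S Q t) :=
  hq.measurable_Q_zero.prodMk
    ((measurable_pi_lambda _ fun i : Fin (t + 1) => hq.measurable_X i).prodMk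
      (measurable_pi_lambda _ fun i : Fin t => hq.measurable_S i))

lemma measure_service_eq (t j : ℕ) : Pr {ω | S t ω = j} = νS j := by
  have h := congrArg (fun m : Measure ℕ => m {j}) (hq.law_S t)
  simp only [Measure.map_apply (hq.measurable_S t) (measurableSet_singleton j),
    PMF.toMeasure_apply_singleton _ _ (measurableSet_singleton j)] at h
  exact h

lemma measure_services_eq (t : ℕ) (σ : ℕ → ℕ) :
    Pr {ω | ∀ i < t, S i ω = σ i} = ∏ i ∈ Finset.range t, νS (σ i) := by
  have h := hq.iIndep_S.measure_inter_preimage_eq_mul (Finset.range t)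
    (sets := fun i => {σ i}) (fun i _ => measurableSet_singleton _)
  have e : ⋂ i ∈ Finset.range t, S i ⁻¹' {σ i} = {ω | ∀ i < t, S i ω = σ i} := by
    ext ω; simp
  rw [e] at h
  rw [h]
  exact Finset.prod_congr rfl fun i _ => hq.measure_service_eq i (σ i)

variable [DiscreteMeasurableSpace E]

lemma measure_arrivals_inter_services (t u q : ℕ) (x : ℕ → E) (σ : ℕ → ℕ) :
    Pr {ω | (Q 0 ω = q ∧ ∀ i ≤ t, X i ω = x i) ∧ ∀ i < u, S i ω = σ i} =
      Pr {ω | Q 0 ω = q ∧ ∀ i ≤ t, X i ω = x i} * Pr {ω | ∀ i < u, S i ω = σ i} := by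
  have hA : MeasurableSet {z : ℕ × (ℕ → E) | z.1 = q ∧ ∀ i ≤ t, z.2 i = x i} := by
    have : {z : ℕ × (ℕ → E) | z.1 = q ∧ ∀ i ≤ t, z.2 i = x i} =
        Prod.fst ⁻¹' {q} ∩ ⋂ i ∈ Set.Iic t, (fun z : ℕ × (ℕ → E) => z.2 i) ⁻¹' {x i} := by
      ext z; simp
    rw [this]
    refine (measurable_fst (measurableSet_singleton q)).inter
      (MeasurableSet.biInter (Set.to_countable _) fun i _ => ?_)
    exact ((measurable_pi_apply i).comp measurable_snd) (MeasurableSet.of_discrete)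
  have hB : MeasurableSet {z : ℕ → ℕ | ∀ i < u, z i = σ i} := by
    have : {z : ℕ → ℕ | ∀ i < u, z i = σ i} =
        ⋂ i ∈ Set.Iio u, (fun z : ℕ → ℕ => z i) ⁻¹' {σ i} := by
      ext z; simp
    rw [this]
    exact MeasurableSet.biInter (Set.to_countable _) fun i _ =>
      (measurable_pi_apply i) (measurableSet_singleton _)
  exact hq.indep_arrivals_services.measure_inter_preimage_eq_mul _ _ hA hB

/-- The event is a cylinder in arrivals and services. Independence splits it, the Markov property
supplies the factor `P`, and the product law of the services supplies `νS j`. -/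
lemma measure_history_step (t j : ℕ) (y : E) (ω₀ : Ω) :
    Pr {ω | history X S Q t ω = history X S Q t ω₀ ∧ S t ω = j ∧ X (t + 1) ω = y} =
      Pr {ω | history X S Q t ω = history X S Q t ω₀} * (νS j * P (X t ω₀) y) := by
  -- The path of `ω₀` is continued by the state `y` at time `t + 1`, and its services by `j` at time
  -- `t`, so both events become cylinders over the same sequences.
  set x : ℕ → E := fun i => if i ≤ t then X i ω₀ else y with hx
  set σ : ℕ → ℕ := fun i => if i < t then S i ω₀ else j with hσ
  have hx1 : ∀ i ≤ t, x i = X i ω₀ := fun i hi => by simp [hx, hi]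
  have hx2 : x (t + 1) = y := by simp [hx]
  have hσ1 : ∀ i < t, σ i = S i ω₀ := fun i hi => by simp [hσ, hi]
  have hσ2 : σ t = j := by simp [hσ]
  have e1 : {ω | history X S Q t ω = history X S Q t ω₀ ∧ S t ω = j ∧ X (t + 1) ω = y} =
      {ω | (Q 0 ω = Q 0 ω₀ ∧ ∀ i ≤ t + 1, X i ω = x i) ∧ ∀ i < t + 1, S i ω = σ i} := by
    ext ω
    simp only [history_eq_iff, Set.mem_ofPred_eq]
    constructor
    · rintro ⟨⟨⟨h0, hX⟩, hS⟩, hj, hy⟩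
      refine ⟨⟨h0, fun i hi => ?_⟩, fun i hi => ?_⟩
      · rcases Nat.lt_or_ge t i with h | h
        · obtain rfl : i = t + 1 := by omega
          rw [hy, hx2]
        · rw [hX i h, hx1 i h]
      · rcases Nat.lt_or_ge i t with h | h
        · rw [hS i h, hσ1 i h]
        · obtain rfl : i = t := by omega
          rw [hj, hσ2]
    · rintro ⟨⟨h0, hX⟩, hS⟩
      exact ⟨⟨⟨h0, fun i hi => (hX i (by omega)).trans (hx1 i hi)⟩,
        fun i hi => (hS i (by omega)).trans (hσ1 i hi)⟩,
        (hS t (by omega)).trans hσ2, (hX (t + 1) le_rfl).trans hx2⟩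
  have e2 : {ω | history X S Q t ω = history X S Q t ω₀} =
      {ω | (Q 0 ω = Q 0 ω₀ ∧ ∀ i ≤ t, X i ω = x i) ∧ ∀ i < t, S i ω = σ i} := by
    ext ω
    simp only [history_eq_iff, Set.mem_ofPred_eq]
    refine and_congr (and_congr Iff.rfl ?_) ?_
    · exact forall₂_congr fun i hi => by rw [hx1 i hi]
    · exact forall₂_congr fun i hi => by rw [hσ1 i hi]
  rw [e1, e2, hq.measure_arrivals_inter_services, hq.measure_arrivals_inter_services, hq.markov,
    hq.measure_services_eq, hq.measure_services_eq, Finset.prod_range_succ, hσ2, hx2,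
    hx1 t le_rfl]
  ring

variable [Finite E]

lemma measurable_queue (t : ℕ) : Measurable (Q t) := by
  induction t with
  | zero => exact hq.measurable_Q_zero
  | succ t ih =>
    have : Q (t + 1) = (fun z : ℕ × E × ℕ => nextQueue z.1 (f z.2.1) z.2.2) ∘
        fun ω => (Q t ω, X t ω, S t ω) := by
      ext ω; exact hq.recursion t ω
    rw [this]
    exact (Measurable.of_discrete).comp (ih.prodMk ((hq.measurable_X t).prodMk (hq.measurable_S t)))

lemma measurable_state (t : ℕ) : Measurable fun ω => (Q t ω, X t ω) :=
  (hq.measurable_queue t).prodMk (hq.measurable_X t)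

/-- The history takes values in a countable space, so point masses determine its law; on each
history the density is constant, because the history fixes `X t`. -/
lemma map_history_restrict (t j : ℕ) (y : E) :
    (Pr.restrict {ω | S t ω = j ∧ X (t + 1) ω = y}).map (history X S Q t) =
      (Pr.withDensity fun ω => νS j * P (X t ω) y).map (history X S Q t) := by
  have hm := hq.measurable_history t
  refine Measure.ext_of_singleton fun h => ?_
  rw [Measure.map_apply hm (measurableSet_singleton h),
    Measure.map_apply hm (measurableSet_singleton h),
    Measure.restrict_apply (hm (measurableSet_singleton h)),
    withDensity_apply _ (hm (measurableSet_singleton h))]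
  by_cases hh : ∃ ω₀, history X S Q t ω₀ = h
  · obtain ⟨ω₀, rfl⟩ := hh
    have key := hq.measure_history_step t j y ω₀
    have : ∫⁻ ω in history X S Q t ⁻¹' {history X S Q t ω₀}, νS j * P (X t ω) y ∂Pr =
        ∫⁻ ω in history X S Q t ⁻¹' {history X S Q t ω₀}, νS j * P (X t ω₀) y ∂Pr := by
      refine setLIntegral_congr_fun (hm (measurableSet_singleton _)) fun ω hω => ?_
      have := ((history_eq_iff.1 hω).1.2 t le_rfl)
      simp only [this]
    rw [this, setLIntegral_const, mul_comm]
    exact key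
  · have : history X S Q t ⁻¹' {h} = ∅ := by
      ext ω
      simp only [Set.mem_preimage, Set.mem_singleton_iff, Set.mem_empty_iff_false, iff_false]
      exact fun h' => hh ⟨ω, h'⟩
    simp [this]

lemma setIntegral_state [IsProbabilityMeasure Pr] (t j : ℕ) (y : E) (W : ℕ × E → ℂ) :
    ∫ ω in {ω | S t ω = j ∧ X (t + 1) ω = y}, W (Q t ω, X t ω) ∂Pr =
      ∫ ω, ((νS j).toReal * (P (X t ω) y).toReal : ℝ) * W (Q t ω, X t ω) ∂Pr := by
  have hm := hq.measurable_history t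
  have hfac : Function.FactorsThrough (fun ω => W (Q t ω, X t ω)) (history X S Q t) := by
    intro ω ω' h
    simp only [hq.queue_eq_of_history_eq h, (history_eq_iff.1 h).1.2 t le_rfl]
  -- `G` expresses `W` at the current state as a function of the history, so the equality of image
  -- measures can be applied to it.
  set G := Function.extend (history X S Q t) (fun ω => W (Q t ω, X t ω)) 0 with hG
  have hGW : ∀ ω, G (history X S Q t ω) = W (Q t ω, X t ω) := fun ω => hfac.extend_apply _ ω
  have hGm : ∀ m : Measure (ℕ × (Fin (t + 1) → E) × (Fin t → ℕ)), AEStronglyMeasurable G m :=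
    fun m => (Measurable.of_discrete).aestronglyMeasurable
  have h1 := integral_map (μ := Pr.restrict {ω | S t ω = j ∧ X (t + 1) ω = y})
    hm.aemeasurable (hGm _)
  rw [hq.map_history_restrict, integral_map hm.aemeasurable (hGm _)] at h1
  simp only [hGW] at h1
  rw [← h1, integral_withDensity_eq_integral_toReal_smul]
  · refine integral_congr_ae (Eventually.of_forall fun ω => ?_)
    simp [ENNReal.toReal_mul]
  · exact (Measurable.of_discrete (f := fun x : E => νS j * P x y)).comp (hq.measurable_X t)
  · refine Eventually.of_forall fun ω => ENNReal.mul_lt_top ?_ ?_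
    · exact (PMF.apply_ne_top _ _).lt_top
    · exact (PMF.apply_ne_top _ _).lt_top

end IsMarkovModulatedQueue

variable [Fintype E]

/-- The expectation of `V` after one step of the two-dimensional chain, for services in
`{0, …, Smax}`. -/
noncomputable def stepExpect (P : E → PMF E) (f : E → ℕ) (νS : PMF ℕ) (Smax : ℕ)
    (V : ℕ × E → ℂ) (z : ℕ × E) : ℂ :=
  ∑ j ∈ Finset.range (Smax + 1), ∑ y, ((νS j).toReal * (P z.2 y).toReal : ℝ) *
    V (nextQueue z.1 (f z.2) j, y)

/-- Splitting over the finitely many values of the service and of the next modulating state reduces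
the claim to `setIntegral_state`. -/
lemma IsMarkovModulatedQueue.integral_state_succ [DiscreteMeasurableSpace E]
    [IsProbabilityMeasure Pr] (hq : IsMarkovModulatedQueue Pr P f νS X S Q) {Smax : ℕ}
    (hSmax : ∀ s ∈ νS.support, s ≤ Smax) (t : ℕ) (V : ℕ × E → ℂ) (B : ℝ)
    (hV : ∀ z, ‖V z‖ ≤ B) :
    ∫ ω, V (Q (t + 1) ω, X (t + 1) ω) ∂Pr =
      ∫ ω, stepExpect P f νS Smax V (Q t ω, X t ω) ∂Pr := by
  have hst := hq.measurable_state t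
  have hset : ∀ j y, MeasurableSet {ω | S t ω = j ∧ X (t + 1) ω = y} := fun j y =>
    (hq.measurable_S t (measurableSet_singleton j)).inter
      (hq.measurable_X (t + 1) (measurableSet_singleton y))
  have hint : ∀ (W : ℕ × E → ℂ) (C : ℝ), (∀ z, ‖W z‖ ≤ C) →
      Integrable (fun ω => W (Q t ω, X t ω)) Pr := fun W C hW =>
    Integrable.of_bound ((Measurable.of_discrete (f := W)).comp hst).aestronglyMeasurable C
      (Eventually.of_forall fun ω => hW _)
  have hintc : ∀ j y, Integrable (fun ω => ((νS j).toReal * (P (X t ω) y).toReal : ℝ) *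
      V (nextQueue (Q t ω) (f (X t ω)) j, y)) Pr := by
    intro j y
    refine hint (fun z => ((νS j).toReal * (P z.2 y).toReal : ℝ) *
      V (nextQueue z.1 (f z.2) j, y)) (1 * B) fun z => ?_
    rw [norm_mul, Complex.norm_real, Real.norm_of_nonneg (by positivity)]
    refine mul_le_mul (mul_le_one₀ ?_ ENNReal.toReal_nonneg ?_) (hV _) (norm_nonneg _) zero_le_one
    · exact ENNReal.toReal_le_of_le_ofReal zero_le_one (by simpa using PMF.coe_le_one _ _)
    · exact ENNReal.toReal_le_of_le_ofReal zero_le_one (by simpa using PMF.coe_le_one _ _)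
  have hS : ∀ᵐ ω ∂Pr, S t ω ∈ Finset.range (Smax + 1) := by
    have : ∀ᵐ s ∂νS.toMeasure, s ∈ Finset.range (Smax + 1) := by
      rw [ae_iff, PMF.toMeasure_apply_eq_zero_iff _ MeasurableSet.of_discrete,
        Set.disjoint_left]
      intro s hs hs'
      exact hs' (by simpa [Nat.lt_succ_iff] using hSmax s hs)
    rw [← hq.law_S t] at this
    exact ae_of_ae_map (hq.measurable_S t).aemeasurable this
  have hdec : ∀ᵐ ω ∂Pr, V (Q (t + 1) ω, X (t + 1) ω) =
      ∑ j ∈ Finset.range (Smax + 1), ∑ y, {ω | S t ω = j ∧ X (t + 1) ω = y}.indicator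
        (fun ω => V (nextQueue (Q t ω) (f (X t ω)) j, y)) ω := by
    filter_upwards [hS] with ω hω
    rw [Finset.sum_eq_single_of_mem (S t ω) hω, Finset.sum_eq_single (X (t + 1) ω)]
    · simp [hq.recursion]
    · intro y _ hy
      simp [Ne.symm hy]
    · simp
    · intro j _ hj
      exact Finset.sum_eq_zero fun y _ => by simp [Ne.symm hj]
  rw [integral_congr_ae hdec, integral_finsetSum]
  · unfold stepExpect
    rw [integral_finsetSum]
    · refine Finset.sum_congr rfl fun j _ => ?_
      rw [integral_finsetSum, integral_finsetSum]
      · refine Finset.sum_congr rfl fun y _ => ?_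
        rw [integral_indicator (hset j y)]
        exact hq.setIntegral_state t j y fun z => V (nextQueue z.1 (f z.2) j, y)
      · exact fun y _ => hintc j y
      · exact fun y _ => (hint (fun z => V (nextQueue z.1 (f z.2) j, y)) B
          fun z => hV _).indicator (hset j y)
    · exact fun j _ => integrable_finsetSum _ fun y _ => hintc j y
  · exact fun j _ => integrable_finsetSum _ fun y _ =>
      (hint (fun z => V (nextQueue z.1 (f z.2) j, y)) B fun z => hV _).indicator (hset j y)

end Markov

/-! ### Expectations on a finite set -/

section Expect

variable {E : Type*} [Fintype E] (p : PMF E) (g k : E → ℝ)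

lemma sum_toReal_eq_one : ∑ x, (p x).toReal = 1 := by
  have h := p.tsum_coe
  rw [tsum_fintype] at h
  rw [← ENNReal.toReal_sum fun x _ => p.apply_ne_top x, h, ENNReal.toReal_one]

lemma expect_const (c : ℝ) : expect p (fun _ => c) = c := by
  rw [expect, ← Finset.sum_mul, sum_toReal_eq_one, one_mul]

lemma expect_add : expect p (fun x => g x + k x) = expect p g + expect p k := by
  simp only [expect, mul_add, Finset.sum_add_distrib]

lemma expect_sub : expect p (fun x => g x - k x) = expect p g - expect p k := by
  simp only [expect, mul_sub, Finset.sum_sub_distrib]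

lemma expect_const_mul (c : ℝ) : expect p (fun x => c * g x) = c * expect p g := by
  simp only [expect, Finset.mul_sum, mul_left_comm]

variable {g k} in
lemma expect_mono (h : ∀ x, g x ≤ k x) : expect p g ≤ expect p k :=
  Finset.sum_le_sum fun x _ => mul_le_mul_of_nonneg_left (h x) ENNReal.toReal_nonneg

variable {g} in
lemma abs_expect_le {B : ℝ} (h : ∀ x, |g x| ≤ B) : |expect p g| ≤ B := by
  rw [abs_le]
  constructor
  · rw [← expect_const p (-B)]
    exact expect_mono p fun x => (abs_le.1 (h x)).1
  · rw [← expect_const p B]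
    exact expect_mono p fun x => (abs_le.1 (h x)).2

lemma sq_expect_le : expect p g ^ 2 ≤ expect p fun x => g x ^ 2 := by
  have h : 0 ≤ expect p fun x => (g x - expect p g) ^ 2 := by
    rw [← expect_const p 0]
    exact expect_mono p fun x => sq_nonneg _
  have e : (fun x => (g x - expect p g) ^ 2) =
      fun x => (g x ^ 2 - (2 * expect p g) * g x) + expect p g ^ 2 := by
    ext x; ring
  rw [e, expect_add, expect_sub, expect_const_mul, expect_const] at h
  linarith

lemma expect_bind (K : E → PMF E) : expect (p.bind K) g = expect p fun x => expect (K x) g := by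
  have h : ∀ y, (p.bind K y).toReal = ∑ x, (p x).toReal * (K x y).toReal := by
    intro y
    rw [PMF.bind_apply, tsum_fintype, ENNReal.toReal_sum]
    · simp only [ENNReal.toReal_mul]
    · exact fun x _ => ENNReal.mul_ne_top (p.apply_ne_top x) ((K x).apply_ne_top y)
  simp only [expect, h, Finset.sum_mul, Finset.mul_sum]
  rw [Finset.sum_comm]
  simp only [mul_assoc]

variable {g} in
lemma abs_expect_sub_le_tvDist (q : PMF E) {B : ℝ} (h : ∀ x, |g x| ≤ B) :
    |expect p g - expect q g| ≤ 2 * B * tvDist p q := by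
  have e : 2 * B * tvDist p q = ∑ x, |(p x).toReal - (q x).toReal| * B := by
    rw [tvDist, ← Finset.sum_mul]; ring
  rw [e, expect, expect, ← Finset.sum_sub_distrib]
  refine (Finset.abs_sum_le_sum_abs _ _).trans (Finset.sum_le_sum fun x _ => ?_)
  rw [← sub_mul, abs_mul]
  exact mul_le_mul_of_nonneg_left (h x) (abs_nonneg _)

lemma hasSum_expect {F : ℕ → E → ℝ} {G : E → ℝ} (h : ∀ x, HasSum (fun m => F m x) (G x)) :
    HasSum (fun m => expect p (F m)) (expect p G) :=
  hasSum_sum fun x _ => (h x).mul_left _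

end Expect

/-! ### Geometric decay and the Poisson equation -/

section Poisson

variable {E : Type*} [Fintype E] {P : E → PMF E} {π : PMF E} {g : E → ℝ}

lemma expect_nStep_zero (x : E) : expect (nStep P 0 x) g = g x := by
  classical
  rw [expect, Finset.sum_eq_single x]
  · simp [nStep, PMF.pure_apply]
  · intro y _ hy
    simp [nStep, PMF.pure_apply, hy]
  · simp

lemma expect_nStep_succ (n : ℕ) (x : E) :
    expect (nStep P (n + 1) x) g = expect (P x) fun y => expect (nStep P n y) g :=
  expect_bind _ _ _

lemma expect_expect_of_isStationary (hπ : IsStationary P π) (g : E → ℝ) :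
    (expect π fun x => expect (P x) g) = expect π g := by
  rw [← expect_bind, hπ]

lemma expect_nStep_of_isStationary (hπ : IsStationary P π) (n : ℕ) :
    (expect π fun x => expect (nStep P n x) g) = expect π g := by
  induction n with
  | zero => simp only [expect_nStep_zero]
  | succ n ih =>
    simp only [expect_nStep_succ]
    rw [expect_expect_of_isStationary hπ, ih]

/-- The expectations of `g` along the chain approach its stationary expectation geometrically. -/
def GeometricDecay (P : E → PMF E) (π : PMF E) (g : E → ℝ) (D α : ℝ) : Prop :=
  ∀ m x, |expect (nStep P m x) g - expect π g| ≤ D * α ^ m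

/-- Mixing is assumed only for `m ≥ 1` and yields `2 * B * C`; the `+ 1` in the constant covers `m =
0`. -/
lemma geometricDecay_of_tvDist_le {C α B : ℝ} (hC : 0 ≤ C)
    (hmix : ∀ m : ℕ, 1 ≤ m → ∀ x, tvDist (nStep P m x) π ≤ C * α ^ m) (hα0 : 0 ≤ α)
    (hB : ∀ x, |g x| ≤ B) : GeometricDecay P π g (2 * B * (C + 1)) α := by
  intro m x
  have hB0 : 0 ≤ B := (abs_nonneg _).trans (hB x)
  rcases Nat.eq_zero_or_pos m with rfl | hm
  · rw [expect_nStep_zero, pow_zero, mul_one]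
    have h := (abs_sub _ _).trans (add_le_add (hB x) (abs_expect_le π hB))
    nlinarith
  · refine (abs_expect_sub_le_tvDist _ _ hB).trans ?_
    have := hmix m hm x
    rw [mul_assoc (2 * B)]
    refine mul_le_mul_of_nonneg_left (this.trans ?_) (by positivity)
    exact mul_le_mul_of_nonneg_right (by linarith) (by positivity)

/-- The solution `∑ₘ (Pᵐ g - π g)` of the Poisson equation of the chain. -/
noncomputable def poisson (P : E → PMF E) (π : PMF E) (g : E → ℝ) (x : E) : ℝ :=
  ∑' m, (expect (nStep P m x) g - expect π g)

variable {D α : ℝ} (hd : GeometricDecay P π g D α) (hα0 : 0 ≤ α) (hα1 : α < 1)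

include hd hα0 hα1

lemma hasSum_poisson (x : E) :
    HasSum (fun m => expect (nStep P m x) g - expect π g) (poisson P π g x) :=
  (Summable.of_norm_bounded ((summable_geometric_of_lt_one hα0 hα1).mul_left D)
    fun m => hd m x).hasSum

lemma abs_poisson_le (x : E) : |poisson P π g x| ≤ D / (1 - α) := by
  rw [div_eq_mul_inv, poisson, ← Real.norm_eq_abs]
  exact tsum_of_norm_bounded ((hasSum_geometric_of_lt_one hα0 hα1).mul_left D) fun m => hd m x

lemma hasSum_expect_poisson (x : E) :
    HasSum (fun m => expect (nStep P (m + 1) x) g - expect π g)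
      (expect (P x) (poisson P π g)) := by
  have h := hasSum_expect (P x) (hasSum_poisson hd hα0 hα1)
  simpa only [expect_sub, expect_const, ← expect_nStep_succ] using h

/-- Applying the transition operator shifts the defining series by one, so exactly its zeroth term
is lost. -/
lemma expect_poisson (x : E) :
    expect (P x) (poisson P π g) = poisson P π g x - (g x - expect π g) := by
  have h := (hasSum_nat_add_iff' 1).2 (hasSum_poisson hd hα0 hα1 x)
  rw [Finset.sum_range_one, expect_nStep_zero] at h
  exact (hasSum_expect_poisson hd hα0 hα1 x).unique h

lemma expect_poisson_of_isStationary (hπ : IsStationary P π) :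
    expect π (poisson P π g) = 0 := by
  have h := hasSum_expect π (hasSum_poisson hd hα0 hα1)
  simp only [expect_sub, expect_const, expect_nStep_of_isStationary hπ, sub_self] at h
  exact h.unique hasSum_zero

end Poisson

/-! ### Autocovariances through the Poisson solution -/

section Autocov

variable {E : Type*} [Fintype E] {P : E → PMF E} {π : PMF E} {f : E → ℕ}

lemma autocov_eq (t : ℕ) :
    autocov P π f t = expect π fun x => ((f x : ℝ) - expect π fun z => (f z : ℝ)) *
      (expect (nStep P t x) (fun y => (f y : ℝ)) - expect π fun z => (f z : ℝ)) := by
  simp only [autocov, expect_sub, expect_const]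

variable {D α : ℝ} (hd : GeometricDecay P π (fun x => (f x : ℝ)) D α)

include hd

lemma abs_autocov_le (t : ℕ) : |autocov P π f t| ≤ D * (D * α ^ t) := by
  rw [autocov_eq]
  refine abs_expect_le _ fun x => ?_
  rw [abs_mul]
  have h0 := hd 0 x
  rw [expect_nStep_zero, pow_zero, mul_one] at h0
  exact mul_le_mul h0 (hd t x) (abs_nonneg _) ((abs_nonneg _).trans h0)

variable (hα0 : 0 ≤ α) (hα1 : α < 1)

include hα0 hα1

lemma hasSum_autocov_succ :
    HasSum (fun t => autocov P π f (t + 1)) (expect π fun x =>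
      ((f x : ℝ) - expect π fun z => (f z : ℝ)) *
        expect (P x) (poisson P π fun x => (f x : ℝ))) := by
  simp only [autocov_eq]
  exact hasSum_expect π fun x => (hasSum_expect_poisson hd hα0 hα1 x).mul_left _

/-- By stationarity the sum is the mean conditional variance of the Poisson solution `h` over one
step, E_π[P(h²) − (P h)²]. -/
lemma autocov_zero_add_tsum_nonneg (hπ : IsStationary P π) :
    0 ≤ autocov P π f 0 + 2 * ∑' t, autocov P π f (t + 1) := by
  rw [(hasSum_autocov_succ hd hα0 hα1).tsum_eq, autocov_eq, ← expect_const_mul, ← expect_add]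
  set h := poisson P π fun x => (f x : ℝ) with hh
  -- Since f − λ = h − P h, this is (h − P h)² + 2 (h − P h) P h = h² − (P h)².
  have e : (fun x => ((f x : ℝ) - expect π fun z => (f z : ℝ)) *
      (expect (nStep P 0 x) (fun y => (f y : ℝ)) - expect π fun z => (f z : ℝ)) +
      2 * (((f x : ℝ) - expect π fun z => (f z : ℝ)) * expect (P x) h)) =
      fun x => h x ^ 2 - expect (P x) h ^ 2 := by
    ext x
    rw [expect_nStep_zero, expect_poisson hd hα0 hα1 x]
    ring
  rw [e, expect_sub, sub_nonneg, ← expect_expect_of_isStationary hπ fun x => h x ^ 2]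
  exact expect_mono _ fun x => sq_expect_le _ _

/-- The stationary mean of the second-order coefficient of the drift. -/
lemma expect_quadratic_drift (hπ : IsStationary P π) {μ ε v : ℝ}
    (hrate : expect π (fun x => (f x : ℝ)) = μ - ε) :
    (expect π fun x => (((f x : ℝ) - μ) ^ 2 + v) / 2 +
      ((f x : ℝ) - μ) * expect (P x) (poisson P π fun x => (f x : ℝ))) =
    (autocov P π f 0 + 2 * ∑' t, autocov P π f (t + 1) + ε ^ 2 + v) / 2 := by
  rw [(hasSum_autocov_succ hd hα0 hα1).tsum_eq, autocov_eq]
  set h := poisson P π fun x => (f x : ℝ) with hh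
  have hPh : (expect π fun x => expect (P x) h) = 0 := by
    rw [expect_expect_of_isStationary hπ, expect_poisson_of_isStationary hd hα0 hα1 hπ]
  -- Recentring at the arrival rate `μ - ε` isolates the autocovariance terms. The terms linear in f
  -- and P h have known means, and what survives of the shift is `ε ^ 2 / 2`.
  have e : (fun x => (((f x : ℝ) - μ) ^ 2 + v) / 2 + ((f x : ℝ) - μ) * expect (P x) h) =
      fun x => (1 / 2) * (((f x : ℝ) - (μ - ε)) * ((f x : ℝ) - (μ - ε))) +
        (((f x : ℝ) - (μ - ε)) * expect (P x) h +
          ((-ε) * expect (P x) h + ((-ε) * (f x : ℝ) + (ε * (μ - ε) + (ε ^ 2 + v) / 2)))) := by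
    ext x; ring
  simp only [expect_nStep_zero, hrate]
  rw [e, expect_add, expect_const_mul, expect_add, expect_add, expect_const_mul, hPh, expect_add,
    expect_const_mul, hrate, expect_const]
  ring

end Autocov

/-! ### Moments of the service distribution -/

section Services

variable {νS : PMF ℕ} {Smax : ℕ} (hSmax : ∀ s ∈ νS.support, s ≤ Smax)

include hSmax

lemma service_apply_eq_zero {j : ℕ} (hj : j ∉ Finset.range (Smax + 1)) : νS j = 0 := by
  by_contra h
  exact hj (by simpa [Nat.lt_succ_iff] using hSmax j ((νS.mem_support_iff j).2 h))

lemma sum_service_eq_one : ∑ j ∈ Finset.range (Smax + 1), (νS j).toReal = 1 := by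
  have h := νS.tsum_coe
  rw [tsum_eq_sum fun j hj => service_apply_eq_zero hSmax hj] at h
  rw [← ENNReal.toReal_sum fun x _ => νS.apply_ne_top x, h, ENNReal.toReal_one]

lemma integral_service (g : ℕ → ℝ) :
    ∫ s, g s ∂νS.toMeasure = ∑ j ∈ Finset.range (Smax + 1), (νS j).toReal * g j := by
  have hs : ∀ᵐ s ∂νS.toMeasure, s ∈ Finset.range (Smax + 1) := by
    rw [ae_iff, PMF.toMeasure_apply_eq_zero_iff _ MeasurableSet.of_discrete, Set.disjoint_left]
    intro s hs hs'
    exact hs' (by simpa [Nat.lt_succ_iff] using hSmax s hs)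
  have hint : Integrable g νS.toMeasure := by
    refine Integrable.of_bound (Measurable.of_discrete).aestronglyMeasurable
      (∑ j ∈ Finset.range (Smax + 1), ‖g j‖) ?_
    filter_upwards [hs] with s hs
    exact Finset.single_le_sum (f := fun j => ‖g j‖) (fun j _ => norm_nonneg _) hs
  rw [PMF.integral_eq_tsum _ _ hint, tsum_eq_sum (s := Finset.range (Smax + 1)) fun j hj => by
    simp [service_apply_eq_zero hSmax hj]]
  simp

lemma sum_service_sq_sub {μ : ℝ} (hμ : ∫ s, (s : ℝ) ∂νS.toMeasure = μ) :
    ∑ j ∈ Finset.range (Smax + 1), (νS j).toReal * ((j : ℝ) - μ) ^ 2 =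
      variance (fun s : ℕ => (s : ℝ)) νS.toMeasure := by
  rw [variance_eq_integral (Measurable.of_discrete).aemeasurable, hμ,
    ← integral_service hSmax fun s => ((s : ℝ) - μ) ^ 2]

end Services

/-! ### Drift of the corrected exponential test function -/

section Drift

lemma nextQueue_eq (q a s : ℕ) : nextQueue q a s = q + a - s := by
  unfold nextQueue; omega

/-- The next queue length q' and the unused service u satisfy q' − u = q + a − j, and one of them is
zero. Therefore exp(s q') + exp(−s u) = exp(s (q' − u)) + 1. -/
lemma exp_mul_nextQueue (s : ℂ) (q a j : ℕ) :
    Complex.exp (s * (nextQueue q a j : ℕ)) =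
      Complex.exp (s * q) * Complex.exp (s * ((a : ℝ) - (j : ℝ) : ℝ)) -
        (Complex.exp (-(s * ((j - (q + a) : ℕ) : ℝ))) - 1) := by
  rw [nextQueue_eq, ← Complex.exp_add]
  rcases le_total j (q + a) with h | h
  · rw [Nat.sub_eq_zero_of_le h]
    push_cast [h]
    simp only [mul_zero, neg_zero, Complex.exp_zero, sub_self, sub_zero]
    congr 1; ring
  · rw [Nat.sub_eq_zero_of_le h]
    push_cast [h]
    rw [mul_zero, Complex.exp_zero, sub_sub_eq_add_sub, eq_sub_iff_add_eq, add_comm (1 : ℂ)]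
    congr 2; ring

variable {n : ℕ} {w : ℕ → ℝ} {μ v : ℝ} (hw0 : ∀ j, 0 ≤ w j)
  (hw1 : ∑ j ∈ Finset.range (n + 1), w j = 1)

lemma norm_exp_sub_quadratic_le {s : ℂ} (hs : ‖s‖ ≤ 1) {x L : ℝ} (hx : |x| ≤ L) :
    ‖Complex.exp (s * x) - (1 + s * x + (s * x) ^ 2 / 2)‖ ≤ L ^ 3 * Real.exp L * ‖s‖ ^ 3 := by
  have h := Complex.norm_exp_sub_sum_le_norm_mul_exp (s * x) 3
  have hn : ‖s * x‖ ≤ ‖s‖ * L := by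
    rw [norm_mul, Complex.norm_real, Real.norm_eq_abs]
    exact mul_le_mul_of_nonneg_left hx (norm_nonneg _)
  have hL : 0 ≤ L := (abs_nonneg _).trans hx
  have hn' : ‖s * x‖ ≤ L := hn.trans (mul_le_of_le_one_left hL hs)
  simp only [Finset.sum_range_succ, Finset.range_zero, Finset.sum_empty, pow_zero, zero_add,
    Nat.factorial, Nat.cast_one, div_one, pow_one, mul_one, Nat.succ_eq_add_one,
    Nat.reduceAdd, Nat.cast_ofNat] at h
  refine h.trans ?_
  calc ‖s * x‖ ^ 3 * Real.exp ‖s * x‖ ≤ (‖s‖ * L) ^ 3 * Real.exp L := by gcongr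
    _ = _ := by ring

/-- One factor `u` is kept in the bound: unused service will average to `ε`, which makes this error
small enough at scale `s = ε z`. -/
lemma norm_exp_sub_linear_le {s : ℂ} (hs : ‖s‖ ≤ 1) {u N : ℝ} (hu0 : 0 ≤ u) (hu : u ≤ N) :
    ‖Complex.exp (-(s * u)) - 1 + s * u‖ ≤ N * Real.exp N * (‖s‖ ^ 2 * u) := by
  have h := Complex.norm_exp_sub_sum_le_norm_mul_exp (-(s * u)) 2
  have hn : ‖-(s * u)‖ = ‖s‖ * u := by
    rw [norm_neg, norm_mul, Complex.norm_real, Real.norm_of_nonneg hu0]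
  have hn' : ‖s‖ * u ≤ N := (mul_le_of_le_one_left hu0 hs).trans hu
  simp only [Finset.sum_range_succ, Finset.range_zero, Finset.sum_empty, pow_zero, zero_add,
    Nat.factorial, Nat.cast_one, div_one, pow_one, mul_one, Nat.succ_eq_add_one, hn] at h
  rw [← sub_sub, sub_neg_eq_add] at h
  refine h.trans ?_
  calc (‖s‖ * u) ^ 2 * Real.exp (‖s‖ * u) ≤ (‖s‖ * u) ^ 2 * Real.exp N := by gcongr
    _ = u * Real.exp N * (‖s‖ ^ 2 * u) := by ring
    _ ≤ _ := by gcongr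

include hw0 hw1 in
lemma norm_exp_moment_sub_le (hwμ : ∑ j ∈ Finset.range (n + 1), w j * (j : ℝ) = μ)
    (hwv : ∑ j ∈ Finset.range (n + 1), w j * ((j : ℝ) - μ) ^ 2 = v) {s : ℂ} (hs : ‖s‖ ≤ 1)
    {a L : ℝ} (hL : ∀ j ∈ Finset.range (n + 1), |a - j| ≤ L) :
    ‖(∑ j ∈ Finset.range (n + 1), (w j : ℂ) * Complex.exp (s * (a - (j : ℝ) : ℝ))) -
      (1 + s * ((a - μ : ℝ) : ℂ) + s ^ 2 * ((((a - μ) ^ 2 + v) / 2 : ℝ) : ℂ))‖ ≤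
        L ^ 3 * Real.exp L * ‖s‖ ^ 3 := by
  have h1 : ∑ j ∈ Finset.range (n + 1), w j * (a - j) = a - μ := by
    simp only [mul_sub, Finset.sum_sub_distrib, ← Finset.sum_mul, hw1, hwμ, one_mul]
  have h2 : ∑ j ∈ Finset.range (n + 1), w j * (a - j) ^ 2 = (a - μ) ^ 2 + v := by
    have e : ∀ j ∈ Finset.range (n + 1), w j * (a - j) ^ 2 =
        2 * (a - μ) * (w j * (a - j)) - (a - μ) ^ 2 * w j + w j * ((j : ℝ) - μ) ^ 2 :=
      fun j _ => by ring
    rw [Finset.sum_congr rfl e, Finset.sum_add_distrib, Finset.sum_sub_distrib, ← Finset.mul_sum,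
      ← Finset.mul_sum, h1, hw1, hwv]
    ring
  have e : 1 + s * ((a - μ : ℝ) : ℂ) + s ^ 2 * ((((a - μ) ^ 2 + v) / 2 : ℝ) : ℂ) =
      ∑ j ∈ Finset.range (n + 1), (w j : ℂ) * (1 + s * ((a - (j : ℝ) : ℝ) : ℂ) +
        (s * ((a - (j : ℝ) : ℝ) : ℂ)) ^ 2 / 2) := by
    have h0 : (1 : ℂ) = ∑ j ∈ Finset.range (n + 1), (w j : ℂ) := by exact_mod_cast hw1.symm
    rw [← h2, ← h1]
    push_cast
    conv_lhs => rw [h0]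
    rw [Finset.mul_sum, Finset.sum_div, Finset.mul_sum, ← Finset.sum_add_distrib,
      ← Finset.sum_add_distrib]
    exact Finset.sum_congr rfl fun j _ => by ring
  rw [e, ← Finset.sum_sub_distrib]
  calc _ ≤ ∑ j ∈ Finset.range (n + 1), w j * (L ^ 3 * Real.exp L * ‖s‖ ^ 3) := by
        refine norm_sum_le_of_le _ fun j hj => ?_
        rw [← mul_sub, norm_mul, Complex.norm_real, Real.norm_of_nonneg (hw0 j)]
        exact mul_le_mul_of_nonneg_left (norm_exp_sub_quadratic_le hs (hL j hj)) (hw0 j)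
    _ = _ := by rw [← Finset.sum_mul, hw1, one_mul]

include hw0 in
-- To leading order the reflection at zero contributes `s` times the mean unused service; replacing
-- the correction factor `G` by 1 costs another factor of order `‖s‖`.
lemma norm_unused_sub_le {s G : ℂ} (hs : ‖s‖ ≤ 1) {c N : ℝ} (hG : ‖G - 1‖ ≤ c * ‖s‖)
    (hc : 0 ≤ c) {u : ℕ → ℝ} (hu0 : ∀ j, 0 ≤ u j) (hu : ∀ j ∈ Finset.range (n + 1), u j ≤ N) :
    ‖-(G * ∑ j ∈ Finset.range (n + 1), (w j : ℂ) * (Complex.exp (-(s * u j)) - 1)) -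
      s * ((∑ j ∈ Finset.range (n + 1), w j * u j : ℝ) : ℂ)‖ ≤
        ((1 + c) * (N * Real.exp N) + c) *
          (‖s‖ ^ 2 * ∑ j ∈ Finset.range (n + 1), w j * u j) := by
  have hN : 0 ≤ N := (hu0 0).trans (hu 0 (by simp))
  have hG1 : ‖G‖ ≤ 1 + c := by
    calc ‖G‖ = ‖1 + (G - 1)‖ := by ring_nf
      _ ≤ ‖(1 : ℂ)‖ + ‖G - 1‖ := norm_add_le _ _
      _ ≤ 1 + c * 1 := by
        rw [norm_one]
        exact add_le_add_right (hG.trans (mul_le_mul_of_nonneg_left hs hc)) _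
      _ = _ := by ring
  have e : -(G * ∑ j ∈ Finset.range (n + 1), (w j : ℂ) * (Complex.exp (-(s * u j)) - 1)) -
      s * ((∑ j ∈ Finset.range (n + 1), w j * u j : ℝ) : ℂ) =
      ∑ j ∈ Finset.range (n + 1), (w j : ℂ) *
        (-(G * (Complex.exp (-(s * u j)) - 1 + s * u j)) + (G - 1) * (s * u j)) := by
    push_cast
    rw [Finset.mul_sum, Finset.mul_sum, ← Finset.sum_neg_distrib, ← Finset.sum_sub_distrib]
    exact Finset.sum_congr rfl fun j _ => by ring
  rw [e, Finset.mul_sum, Finset.mul_sum]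
  refine norm_sum_le_of_le _ fun j hj => ?_
  rw [norm_mul, Complex.norm_real, Real.norm_of_nonneg (hw0 j)]
  have h1 : ‖-(G * (Complex.exp (-(s * u j)) - 1 + s * u j)) + (G - 1) * (s * u j)‖ ≤
      (1 + c) * (N * Real.exp N * (‖s‖ ^ 2 * u j)) + (c * ‖s‖) * (‖s‖ * u j) := by
    refine (norm_add_le _ _).trans (add_le_add ?_ ?_)
    · rw [norm_neg, norm_mul]
      exact mul_le_mul hG1 (norm_exp_sub_linear_le hs (hu0 j) (hu j hj)) (norm_nonneg _)
        (by positivity)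
    · rw [norm_mul, norm_mul s, Complex.norm_real, Real.norm_of_nonneg (hu0 j)]
      exact mul_le_mul_of_nonneg_right hG (mul_nonneg (norm_nonneg _) (hu0 j))
  calc _ ≤ w j * _ := mul_le_mul_of_nonneg_left h1 (hw0 j)
    _ = _ := by ring

/-- The second-order expansion of the perturbed moment generating function. -/
lemma norm_perturbed_sub_le {s M : ℂ} (hs : ‖s‖ ≤ 1) {D R M1 M2 h Ph k Pk ε F : ℝ} (hD : 0 ≤ D)
    (hM : ‖M - (1 + s * M1 + s ^ 2 * M2)‖ ≤ R * ‖s‖ ^ 3) (h1 : |M1| ≤ D) (h2 : |M2| ≤ D)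
    (h3 : |Ph| ≤ D) (h4 : |Pk| ≤ D) (hh : Ph = h - (M1 + ε))
    (hk : Pk = k - (M2 + M1 * Ph - F)) :
    ‖(1 + s * Ph + s ^ 2 * Pk) * M - (1 + s * h + s ^ 2 * k) - (-(s * ε) + s ^ 2 * F)‖ ≤
      (3 * D ^ 2 + (1 + 2 * D) * R) * ‖s‖ ^ 3 := by
  have hn : ∀ {x : ℝ}, |x| ≤ D → ‖(x : ℂ)‖ ≤ D := fun {x} hx => by
    rwa [Complex.norm_real, Real.norm_eq_abs]
  have hs2 : ‖s‖ ^ 2 ≤ 1 := pow_le_one₀ (norm_nonneg _) hs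
  have hh' : (h : ℂ) = Ph + (M1 + ε) := by exact_mod_cast (by linarith : h = Ph + (M1 + ε))
  have hk' : (k : ℂ) = Pk + (M2 + M1 * Ph - F) := by
    exact_mod_cast (by linarith : k = Pk + (M2 + M1 * Ph - F))
  -- The relations for `h` and `k` cancel all terms of order 1, s and s² exactly; what remains is
  -- three products of higher order and the Taylor error of `M`.
  have e : (1 + s * Ph + s ^ 2 * Pk) * M - (1 + s * h + s ^ 2 * k) - (-(s * ε) + s ^ 2 * F) =
      s ^ 3 * (M1 * Pk) + s ^ 3 * (M2 * Ph) + s ^ 3 * (s * (M2 * Pk)) +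
        (1 + s * Ph + s ^ 2 * Pk) * (M - (1 + s * M1 + s ^ 2 * M2)) := by
    rw [hh', hk']; ring
  have hmul : ∀ {x y : ℝ}, |x| ≤ D → |y| ≤ D → ‖(x : ℂ) * y‖ ≤ D ^ 2 := fun {x y} hx hy => by
    rw [norm_mul, sq]
    exact mul_le_mul (hn hx) (hn hy) (norm_nonneg _) hD
  have hG : ‖1 + s * Ph + s ^ 2 * Pk‖ ≤ 1 + 2 * D := by
    have a1 : ‖s * Ph‖ ≤ 1 * D := by
      rw [norm_mul]; exact mul_le_mul hs (hn h3) (norm_nonneg _) zero_le_one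
    have a2 : ‖s ^ 2 * Pk‖ ≤ 1 * D := by
      rw [norm_mul, norm_pow]; exact mul_le_mul hs2 (hn h4) (norm_nonneg _) zero_le_one
    have := norm_add₃_le (a := (1 : ℂ)) (b := s * Ph) (c := s ^ 2 * Pk)
    rw [norm_one] at this
    linarith
  rw [e]
  have b1 : ‖s ^ 3 * ((M1 : ℂ) * Pk)‖ ≤ ‖s‖ ^ 3 * D ^ 2 := by
    rw [norm_mul, norm_pow]
    exact mul_le_mul_of_nonneg_left (hmul h1 h4) (by positivity)
  have b2 : ‖s ^ 3 * ((M2 : ℂ) * Ph)‖ ≤ ‖s‖ ^ 3 * D ^ 2 := by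
    rw [norm_mul, norm_pow]
    exact mul_le_mul_of_nonneg_left (hmul h2 h3) (by positivity)
  have b3 : ‖s ^ 3 * (s * ((M2 : ℂ) * Pk))‖ ≤ ‖s‖ ^ 3 * (1 * D ^ 2) := by
    rw [norm_mul, norm_pow, norm_mul s]
    exact mul_le_mul_of_nonneg_left (mul_le_mul hs (hmul h2 h4) (norm_nonneg _) zero_le_one)
      (by positivity)
  have b4 : ‖(1 + s * Ph + s ^ 2 * Pk) * (M - (1 + s * M1 + s ^ 2 * M2))‖ ≤
      (1 + 2 * D) * (R * ‖s‖ ^ 3) := by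
    rw [norm_mul]
    exact mul_le_mul hG hM (norm_nonneg _) (by positivity)
  have := norm_add_le (s ^ 3 * ((M1 : ℂ) * Pk) + s ^ 3 * (M2 * Ph) + s ^ 3 * (s * (M2 * Pk)))
    ((1 + s * Ph + s ^ 2 * Pk) * (M - (1 + s * M1 + s ^ 2 * M2)))
  have := norm_add₃_le (a := s ^ 3 * ((M1 : ℂ) * Pk)) (b := s ^ 3 * ((M2 : ℂ) * Ph))
    (c := s ^ 3 * (s * ((M2 : ℂ) * Pk)))
  linarith

variable {E : Type*} [Fintype E] {P : E → PMF E} {f : E → ℕ} {νS : PMF ℕ} {Smax : ℕ}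

/-- The mean unused service in a given state of the two-dimensional chain. -/
noncomputable def meanUnused {E : Type*} (f : E → ℕ) (νS : PMF ℕ) (Smax : ℕ) (z : ℕ × E) : ℝ :=
  ∑ j ∈ Finset.range (Smax + 1), (νS j).toReal * ((j - (z.1 + f z.2) : ℕ) : ℝ)

/-- The exponential test function with its first- and second-order corrections. -/
noncomputable def testFun {E : Type*} (h k : E → ℝ) (s : ℂ) (z : ℕ × E) : ℂ :=
  Complex.exp (s * z.1) * (1 + s * h z.2 + s ^ 2 * k z.2)

lemma stepExpect_testFun (h k : E → ℝ) (s : ℂ) (z : ℕ × E) :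
    stepExpect P f νS Smax (testFun h k s) z =
      (∑ j ∈ Finset.range (Smax + 1), ((νS j).toReal : ℂ) *
        Complex.exp (s * (nextQueue z.1 (f z.2) j : ℕ))) *
          (1 + s * (expect (P z.2) h : ℝ) + s ^ 2 * (expect (P z.2) k : ℝ)) := by
  have e : 1 + s * (expect (P z.2) h : ℝ) + s ^ 2 * (expect (P z.2) k : ℝ) =
      ∑ y, ((P z.2 y).toReal : ℂ) * (1 + s * h y + s ^ 2 * k y) := by
    have h0 : (1 : ℂ) = ∑ y, ((P z.2 y).toReal : ℂ) := by
      exact_mod_cast (sum_toReal_eq_one (P z.2)).symm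
    rw [expect, expect]
    push_cast
    conv_lhs => rw [h0]
    rw [Finset.mul_sum, Finset.mul_sum, ← Finset.sum_add_distrib, ← Finset.sum_add_distrib]
    exact Finset.sum_congr rfl fun y _ => by ring
  rw [e, Finset.sum_mul_sum]
  refine Finset.sum_congr rfl fun j _ => Finset.sum_congr rfl fun y _ => ?_
  simp only [testFun]
  push_cast
  ring

lemma norm_exp_mul_nat_le_one {s : ℂ} (hs : s.re ≤ 0) (q : ℕ) : ‖Complex.exp (s * q)‖ ≤ 1 := by
  rw [Complex.norm_exp, Real.exp_le_one_iff, Complex.mul_re, Complex.natCast_re,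
    Complex.natCast_im, mul_zero, sub_zero]
  exact mul_nonpos_of_nonpos_of_nonneg hs (Nat.cast_nonneg _)

lemma norm_testFun_le {E : Type*} {h k : E → ℝ} {D : ℝ} (hh : ∀ x, |h x| ≤ D) (hk : ∀ x, |k x| ≤ D) {s : ℂ}
    (hs : ‖s‖ ≤ 1) (hs0 : s.re ≤ 0) (z : ℕ × E) : ‖testFun h k s z‖ ≤ 1 + 2 * D := by
  have a1 : ‖s * (h z.2 : ℂ)‖ ≤ 1 * D := by
    rw [norm_mul, Complex.norm_real, Real.norm_eq_abs]
    exact mul_le_mul hs (hh _) (abs_nonneg _) zero_le_one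
  have a2 : ‖s ^ 2 * (k z.2 : ℂ)‖ ≤ 1 * D := by
    rw [norm_mul, norm_pow, Complex.norm_real, Real.norm_eq_abs]
    exact mul_le_mul (pow_le_one₀ (norm_nonneg _) hs) (hk _) (abs_nonneg _) zero_le_one
  have := norm_add₃_le (a := (1 : ℂ)) (b := s * h z.2) (c := s ^ 2 * k z.2)
  rw [norm_one] at this
  rw [testFun, norm_mul]
  exact (mul_le_of_le_one_left (norm_nonneg _) (norm_exp_mul_nat_le_one hs0 _)).trans
    (by linarith)

/-- The constant in the drift estimate. -/
noncomputable def driftConst (Amax Smax : ℕ) (D : ℝ) : ℝ :=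
  (3 * D ^ 2 + (1 + 2 * D) * (((Amax + Smax : ℕ) : ℝ) ^ 3 * Real.exp (Amax + Smax : ℕ))) +
    ((1 + 2 * D) * (Smax * Real.exp Smax) + 2 * D)

lemma norm_drift_sub_le (hSmax : ∀ s ∈ νS.support, s ≤ Smax)
    (hμ : ∫ s, (s : ℝ) ∂νS.toMeasure = μ)
    (hv : variance (fun s : ℕ => (s : ℝ)) νS.toMeasure = v) {Amax : ℕ} (hA : ∀ x, f x ≤ Amax)
    {h k : E → ℝ} {D ε F : ℝ} (hD : 0 ≤ D)
    (h1 : ∀ x, |(f x : ℝ) - μ| ≤ D) (h2 : ∀ x, |(((f x : ℝ) - μ) ^ 2 + v) / 2| ≤ D)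
    (h3 : ∀ x, |h x| ≤ D) (h4 : ∀ x, |k x| ≤ D)
    (hh : ∀ x, expect (P x) h = h x - ((f x : ℝ) - μ + ε))
    (hk : ∀ x, expect (P x) k =
      k x - ((((f x : ℝ) - μ) ^ 2 + v) / 2 + ((f x : ℝ) - μ) * expect (P x) h - F))
    {s : ℂ} (hs : ‖s‖ ≤ 1) (hs0 : s.re ≤ 0) (z : ℕ × E) :
    ‖stepExpect P f νS Smax (testFun h k s) z - testFun h k s z -
        Complex.exp (s * z.1) * (-(s * ε) + s ^ 2 * F) - s * meanUnused f νS Smax z‖ ≤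
      driftConst Amax Smax D * (‖s‖ ^ 3 + ‖s‖ ^ 2 * meanUnused f νS Smax z) := by
  obtain ⟨q, x⟩ := z
  set w : ℕ → ℝ := fun j => (νS j).toReal with hw
  have hw0 : ∀ j, 0 ≤ w j := fun j => ENNReal.toReal_nonneg
  set M : ℂ := ∑ j ∈ Finset.range (Smax + 1), (w j : ℂ) *
    Complex.exp (s * ((f x : ℝ) - (j : ℝ) : ℝ)) with hM
  set G : ℂ := 1 + s * (expect (P x) h : ℝ) + s ^ 2 * (expect (P x) k : ℝ) with hG
  have hMle := norm_exp_moment_sub_le (a := (f x : ℝ)) (L := (Amax + Smax : ℕ)) hw0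
    (sum_service_eq_one hSmax)
    ((integral_service hSmax fun s => (s : ℝ)).symm.trans hμ)
    ((sum_service_sq_sub hSmax hμ).trans hv) hs (fun j hj => by
      have hj' : (j : ℝ) ≤ Smax := by
        exact_mod_cast Nat.lt_succ_iff.1 (Finset.mem_range.1 hj)
      have hf : (f x : ℝ) ≤ Amax := by exact_mod_cast hA x
      have hj0 : (0 : ℝ) ≤ j := Nat.cast_nonneg _
      have hf0 : (0 : ℝ) ≤ f x := Nat.cast_nonneg _
      push_cast
      rw [abs_le]
      constructor <;> linarith)
  have hPh := abs_expect_le (P x) h3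
  have hPk := abs_expect_le (P x) h4
  have hA1 := norm_perturbed_sub_le hs hD hMle (h1 x) (h2 x) hPh hPk (hh x) (hk x)
  have hGle : ‖G - 1‖ ≤ 2 * D * ‖s‖ := by
    have e : G - 1 = s * (expect (P x) h : ℝ) + s * (s * (expect (P x) k : ℝ)) := by
      rw [hG]; ring
    rw [e]
    have a1 : ‖s * ((expect (P x) h : ℝ) : ℂ)‖ ≤ ‖s‖ * D := by
      rw [norm_mul, Complex.norm_real]
      exact mul_le_mul_of_nonneg_left hPh (norm_nonneg _)
    have a2 : ‖s * (s * ((expect (P x) k : ℝ) : ℂ))‖ ≤ ‖s‖ * (1 * D) := by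
      rw [norm_mul, norm_mul, Complex.norm_real]
      exact mul_le_mul_of_nonneg_left (mul_le_mul hs hPk (abs_nonneg _) zero_le_one)
        (norm_nonneg _)
    have := norm_add_le (s * ((expect (P x) h : ℝ) : ℂ)) (s * (s * ((expect (P x) k : ℝ) : ℂ)))
    linarith
  have hB := norm_unused_sub_le (n := Smax) hw0 hs (N := Smax) hGle (by positivity)
    (u := fun j => ((j - (q + f x) : ℕ) : ℝ)) (fun j => Nat.cast_nonneg _) (fun j hj => by
      have := Finset.mem_range.1 hj
      exact_mod_cast (by omega : j - (q + f x) ≤ Smax))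
  have hstep : stepExpect P f νS Smax (testFun h k s) (q, x) =
      (Complex.exp (s * q) * M - ∑ j ∈ Finset.range (Smax + 1), (w j : ℂ) *
        (Complex.exp (-(s * ((j - (q + f x) : ℕ) : ℝ))) - 1)) * G := by
    rw [stepExpect_testFun, hM, Finset.mul_sum, ← Finset.sum_sub_distrib]
    congr 1
    refine Finset.sum_congr rfl fun j _ => ?_
    rw [exp_mul_nextQueue]
    ring
  set B : ℂ := ∑ j ∈ Finset.range (Smax + 1), (w j : ℂ) *
        (Complex.exp (-(s * ((j - (q + f x) : ℕ) : ℝ))) - 1) with hBdef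
  set u : ℝ := meanUnused f νS Smax (q, x) with hu
  have hu0 : 0 ≤ u := Finset.sum_nonneg fun j _ => mul_nonneg (hw0 j) (Nat.cast_nonneg _)
  have e : stepExpect P f νS Smax (testFun h k s) (q, x) - testFun h k s (q, x) -
        Complex.exp (s * q) * (-(s * ε) + s ^ 2 * F) - s * u =
      Complex.exp (s * q) * (G * M - (1 + s * h x + s ^ 2 * k x) - (-(s * ε) + s ^ 2 * F)) +
        (-(G * B) - s * u) := by
    rw [hstep, testFun]; ring
  rw [e]
  have hA2 : ‖Complex.exp (s * q) *
      (G * M - (1 + s * h x + s ^ 2 * k x) - (-(s * ε) + s ^ 2 * F))‖ ≤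
      (3 * D ^ 2 + (1 + 2 * D) * (((Amax + Smax : ℕ) : ℝ) ^ 3 * Real.exp (Amax + Smax : ℕ))) *
        ‖s‖ ^ 3 := by
    rw [norm_mul]
    exact (mul_le_of_le_one_left (norm_nonneg _) (norm_exp_mul_nat_le_one hs0 q)).trans hA1
  refine (norm_add_le _ _).trans ((add_le_add hA2 hB).trans ?_)
  rw [driftConst]
  have p1 : 0 ≤ 3 * D ^ 2 +
    (1 + 2 * D) * (((Amax + Smax : ℕ) : ℝ) ^ 3 * Real.exp (Amax + Smax : ℕ)) := by positivity
  have p2 : 0 ≤ (1 + 2 * D) * (Smax * Real.exp Smax) + 2 * D := by positivity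
  have p3 : 0 ≤ ‖s‖ ^ 3 := by positivity
  have p4 : 0 ≤ ‖s‖ ^ 2 * u := by positivity
  have hu' : ∑ j ∈ Finset.range (Smax + 1), w j * ((j - (q + f x) : ℕ) : ℝ) = u := rfl
  rw [hu']
  -- The two error constants are added in `driftConst`; the cross terms of the product are
  -- nonnegative and can be dropped.
  nlinarith [mul_nonneg p1 p4, mul_nonneg p2 p3]

end Drift

/-! ### Time averages and the transform equation for fixed `ε` -/

lemma norm_timeAverage_le {v e : ℕ → ℂ} {u : ℕ → ℝ} {ψ c s : ℂ} {K a b B U : ℝ} {φ : ℕ → ℕ}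
    (hφ : Tendsto φ atTop atTop) (hv : ∀ t, ‖v t‖ ≤ B) (he : Tendsto e atTop (𝓝 ψ))
    (hu : Tendsto (fun n => ((φ n : ℝ)⁻¹) * ∑ t ∈ Finset.range (φ n), u t) atTop (𝓝 U))
    (h : ∀ t, ‖v (t + 1) - v t - e t * c - s * u t‖ ≤ K * (a + b * u t)) :
    ‖ψ * c + s * U‖ ≤ K * (a + b * U) := by
  have hinv : Tendsto (fun n => ((φ n : ℝ)⁻¹)) atTop (𝓝 0) :=
    (tendsto_inv_atTop_nhds_zero_nat (𝕜 := ℝ)).comp hφ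
  -- The increments of `v` telescope, and boundedness makes their average vanish.
  have h1 : Tendsto (fun n => ((φ n : ℝ)⁻¹) • (v (φ n) - v 0)) atTop (𝓝 0) := by
    refine squeeze_zero_norm (a := fun n => (φ n : ℝ)⁻¹ * (B + B)) (fun n => ?_) ?_
    · rw [norm_smul, Real.norm_of_nonneg (by positivity)]
      exact mul_le_mul_of_nonneg_left ((norm_sub_le _ _).trans (add_le_add (hv _) (hv _)))
        (by positivity)
    · simpa using hinv.mul_const (B + B)
  have h2 : Tendsto (fun n => ((φ n : ℝ)⁻¹) • ∑ t ∈ Finset.range (φ n), e t) atTop (𝓝 ψ) :=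
    he.cesaro_smul.comp hφ
  have h3 : Tendsto (fun n => (((φ n : ℝ)⁻¹ * ∑ t ∈ Finset.range (φ n), u t : ℝ) : ℂ)) atTop
      (𝓝 (U : ℂ)) := (Complex.continuous_ofReal.tendsto U).comp hu
  have hL := ((h1.sub (h2.mul_const c)).sub (h3.const_mul s)).norm
  have h4 : Tendsto (fun n => K * (a + b * (((φ n : ℝ)⁻¹) * ∑ t ∈ Finset.range (φ n), u t)))
      atTop (𝓝 (K * (a + b * U))) := ((hu.const_mul b).const_add a).const_mul K
  have e0 : ‖ψ * c + s * U‖ = ‖0 - ψ * c - s * U‖ := by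
    rw [← norm_neg]; congr 1; ring
  rw [e0]
  refine le_of_tendsto_of_tendsto hL h4 ?_
  filter_upwards [hφ.eventually_gt_atTop 0] with n hn
  have hn0 : (0 : ℝ) < φ n := by exact_mod_cast hn
  have hn1 : (φ n : ℂ) ≠ 0 := by exact_mod_cast hn.ne'
  have e1 : ((φ n : ℝ)⁻¹) • (v (φ n) - v 0) -
      ((φ n : ℝ)⁻¹) • (∑ t ∈ Finset.range (φ n), e t) * c -
      s * (((φ n : ℝ)⁻¹ * ∑ t ∈ Finset.range (φ n), u t : ℝ) : ℂ) =
      ((φ n : ℝ)⁻¹) • ∑ t ∈ Finset.range (φ n), (v (t + 1) - v t - e t * c - s * u t) := by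
    rw [Finset.sum_sub_distrib, Finset.sum_sub_distrib, Finset.sum_range_sub, ← Finset.sum_mul,
      ← Finset.mul_sum]
    simp only [Complex.real_smul]
    push_cast
    ring
  have e2 : K * (a + b * (((φ n : ℝ)⁻¹) * ∑ t ∈ Finset.range (φ n), u t)) =
      (φ n : ℝ)⁻¹ * ∑ t ∈ Finset.range (φ n), K * (a + b * u t) := by
    rw [← Finset.mul_sum, Finset.sum_add_distrib, ← Finset.mul_sum, Finset.sum_const,
      Finset.card_range, nsmul_eq_mul]
    field_simp
  rw [e1, e2, norm_smul, Real.norm_of_nonneg (by positivity)]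
  exact mul_le_mul_of_nonneg_left (norm_sum_le_of_le _ fun t _ => h t) (by positivity)

section Transform

variable {Ω' : Type*} [MeasurableSpace Ω'] {Pr' : Measure Ω'} [IsProbabilityMeasure Pr']
  {Qbar : Ω' → ℕ}

/-- On discrete `ℕ` the exponential is continuous, and `s.re ≤ 0` makes it bounded, so it is an
admissible test function for weak convergence. -/
lemma tendsto_integral_exp_queue {Ω : Type*} [MeasurableSpace Ω] {Pr : Measure Ω}
    [IsProbabilityMeasure Pr] {Q : ℕ → Ω → ℕ}
    (hQ : TendstoInDistribution Q atTop Qbar (fun _ => Pr) Pr') {s : ℂ} (hs : s.re ≤ 0) :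
    Tendsto (fun t => ∫ ω, Complex.exp (s * Q t ω) ∂Pr) atTop
      (𝓝 (∫ ω, Complex.exp (s * Qbar ω) ∂Pr')) := by
  have h := (ProbabilityMeasure.tendsto_iff_forall_integral_rclike_tendsto ℂ).1 hQ.tendsto
    (BoundedContinuousFunction.ofNormedAddCommGroupDiscrete
      (fun q : ℕ => Complex.exp (s * q)) 1 fun q => norm_exp_mul_nat_le_one hs q)
  have hm : ∀ m : Measure ℕ, AEStronglyMeasurable (fun q : ℕ => Complex.exp (s * q)) m :=
    fun m => (Measurable.of_discrete).aestronglyMeasurable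
  have e1 : ∀ t, ∫ q, Complex.exp (s * (q : ℕ)) ∂(Pr.map (Q t)) =
      ∫ ω, Complex.exp (s * Q t ω) ∂Pr := fun t =>
    integral_map (hQ.forall_aemeasurable t) (hm _)
  have e2 : ∫ q, Complex.exp (s * (q : ℕ)) ∂(Pr'.map Qbar) =
      ∫ ω, Complex.exp (s * Qbar ω) ∂Pr' := integral_map hQ.aemeasurable_limit (hm _)
  rw [← e2]
  simp only [← e1]
  exact h

lemma tendsto_integral_exp_nhds_one (hQ : Measurable Qbar) :
    Tendsto (fun n : ℕ => ∫ ω, Complex.exp (((-(1 / ((n : ℝ) + 1)) : ℝ) : ℂ) * Qbar ω) ∂Pr') atTop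
      (𝓝 1) := by
  have h : Tendsto (fun n : ℕ => ∫ ω, Complex.exp (((-(1 / ((n : ℝ) + 1)) : ℝ) : ℂ) * Qbar ω) ∂Pr')
      atTop (𝓝 (∫ _, (1 : ℂ) ∂Pr')) := by
    refine tendsto_integral_of_dominated_convergence (fun _ => (1 : ℝ)) (fun n => ?_)
      (integrable_const _) (fun n => Eventually.of_forall fun ω => ?_)
      (Eventually.of_forall fun ω => ?_)
    · exact ((Measurable.of_discrete (f := fun q : ℕ =>
        Complex.exp (((-(1 / ((n : ℝ) + 1)) : ℝ) : ℂ) * q))).comp hQ).aestronglyMeasurable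
    · refine norm_exp_mul_nat_le_one ?_ _
      rw [Complex.ofReal_re]
      exact neg_nonpos.2 (by positivity)
    · have h0 : Tendsto (fun n : ℕ => ((-(1 / ((n : ℝ) + 1)) : ℝ) : ℂ)) atTop (𝓝 ((-0 : ℝ) : ℂ)) :=
        (Complex.continuous_ofReal.tendsto _).comp tendsto_one_div_add_atTop_nhds_zero_nat.neg
      have h1 := (Complex.continuous_exp.tendsto _).comp (h0.mul_const (Qbar ω : ℂ))
      simpa [Function.comp_def] using h1
  simpa using h

/-- Letting the argument of the transform tend to `0` identifies the mean unused service. -/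
lemma unused_eq_of_transform_bound (hQ : Measurable Qbar) {ε F K U : ℝ}
    (h : ∀ s : ℂ, ‖s‖ ≤ 1 → s.re ≤ 0 →
      ‖(∫ ω, Complex.exp (s * Qbar ω) ∂Pr') * (-(s * ε) + s ^ 2 * F) + s * U‖ ≤
        K * (‖s‖ ^ 3 + ‖s‖ ^ 2 * U)) : U = ε := by
  -- The transform is evaluated at `s = -r n` with `r n = 1 / (n + 1)`; dividing the bound by `r n`
  -- leaves a right side tending to zero.
  set r : ℕ → ℝ := fun n => 1 / ((n : ℝ) + 1) with hr
  have hr0 : ∀ n, 0 < r n := fun n => by positivity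
  have hr1 : ∀ n, r n ≤ 1 := fun n => by
    rw [hr]
    simp only
    rw [div_le_one (by positivity)]
    linarith [(Nat.cast_nonneg n : (0 : ℝ) ≤ n)]
  have hrt : Tendsto r atTop (𝓝 0) := tendsto_one_div_add_atTop_nhds_zero_nat
  set ψ : ℕ → ℂ := fun n => ∫ ω, Complex.exp (((-(r n) : ℝ) : ℂ) * Qbar ω) ∂Pr' with hψ
  have hψt : Tendsto ψ atTop (𝓝 1) := tendsto_integral_exp_nhds_one hQ
  have hb : ∀ n, ‖ψ n * (ε + (r n : ℂ) * F) - U‖ ≤ K * (r n ^ 2 + r n * U) := by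
    intro n
    have hn : ‖((-(r n) : ℝ) : ℂ)‖ = r n := by
      rw [Complex.norm_real, norm_neg, Real.norm_of_nonneg (hr0 n).le]
    have := h ((-(r n) : ℝ) : ℂ) (by rw [hn]; exact hr1 n)
      (by rw [Complex.ofReal_re]; exact neg_nonpos.2 (hr0 n).le)
    rw [hn] at this
    have e : ψ n * (-(((-(r n) : ℝ) : ℂ) * ε) + ((-(r n) : ℝ) : ℂ) ^ 2 * F) +
        ((-(r n) : ℝ) : ℂ) * U = (r n : ℂ) * (ψ n * (ε + (r n : ℂ) * F) - U) := by
      push_cast; ring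
    have this' : ‖ψ n * (-(((-(r n) : ℝ) : ℂ) * ε) + ((-(r n) : ℝ) : ℂ) ^ 2 * F) +
        ((-(r n) : ℝ) : ℂ) * U‖ ≤ K * (r n ^ 3 + r n ^ 2 * U) := this
    rw [e, norm_mul, Complex.norm_real, Real.norm_of_nonneg (hr0 n).le] at this'
    refine le_of_mul_le_mul_left (this'.trans_eq ?_) (hr0 n)
    ring
  have hrc : Tendsto (fun n => (r n : ℂ)) atTop (𝓝 ((0 : ℝ) : ℂ)) :=
    (Complex.continuous_ofReal.tendsto _).comp hrt
  have hl := ((hψt.mul ((hrc.mul_const (F : ℂ)).const_add (ε : ℂ))).sub_const (U : ℂ)).norm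
  have hR := (((hrt.pow 2).add (hrt.mul_const U)).const_mul K)
  have h0 := le_of_tendsto_of_tendsto' hl hR hb
  simp only [Complex.ofReal_zero, zero_mul, add_zero, one_mul, ne_eq, OfNat.ofNat_ne_zero,
    not_false_eq_true, zero_pow, mul_zero] at h0
  have h1 := norm_le_zero_iff.1 h0
  have h2 : (ε : ℂ) = U := sub_eq_zero.1 h1
  exact_mod_cast h2.symm

/-- Averaging the pointwise drift estimate over time gives the equation with some `U` in place of
`ε`; the behaviour at small `s` then identifies `U`. -/
lemma norm_transform_equation_le {Ω E : Type*} [MeasurableSpace Ω] [MeasurableSpace E]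
    [Fintype E] [DiscreteMeasurableSpace E] {Pr : Measure Ω} [IsProbabilityMeasure Pr]
    {P : E → PMF E} {f : E → ℕ} {νS : PMF ℕ} {X : ℕ → Ω → E} {S Q : ℕ → Ω → ℕ}
    (hq : IsMarkovModulatedQueue Pr P f νS X S Q) {Smax : ℕ} {μ v : ℝ}
    (hSmax : ∀ s ∈ νS.support, s ≤ Smax) (hμ : ∫ s, (s : ℝ) ∂νS.toMeasure = μ)
    (hv : variance (fun s : ℕ => (s : ℝ)) νS.toMeasure = v) {Amax : ℕ} (hA : ∀ x, f x ≤ Amax)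
    {h k : E → ℝ} {D ε F : ℝ} (hD : 0 ≤ D)
    (h1 : ∀ x, |(f x : ℝ) - μ| ≤ D) (h2 : ∀ x, |(((f x : ℝ) - μ) ^ 2 + v) / 2| ≤ D)
    (h3 : ∀ x, |h x| ≤ D) (h4 : ∀ x, |k x| ≤ D)
    (hh : ∀ x, expect (P x) h = h x - ((f x : ℝ) - μ + ε))
    (hk : ∀ x, expect (P x) k =
      k x - ((((f x : ℝ) - μ) ^ 2 + v) / 2 + ((f x : ℝ) - μ) * expect (P x) h - F))
    (hQbar_meas : Measurable Qbar) (hQ : TendstoInDistribution Q atTop Qbar (fun _ => Pr) Pr')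
    {s : ℂ} (hs : ‖s‖ ≤ 1) (hs0 : s.re ≤ 0) :
    ‖(∫ ω, Complex.exp (s * Qbar ω) ∂Pr') * (-(s * ε) + s ^ 2 * F) + s * ε‖ ≤
      driftConst Amax Smax D * (‖s‖ ^ 3 + ‖s‖ ^ 2 * ε) := by
  set u : ℕ → ℝ := fun t => ∫ ω, meanUnused f νS Smax (Q t ω, X t ω) ∂Pr with hu
  have hU : ∀ z, 0 ≤ meanUnused f νS Smax z ∧ meanUnused f νS Smax z ≤ Smax := by
    intro z
    refine ⟨Finset.sum_nonneg fun j _ => mul_nonneg ENNReal.toReal_nonneg (Nat.cast_nonneg _), ?_⟩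
    calc meanUnused f νS Smax z ≤
        ∑ j ∈ Finset.range (Smax + 1), (νS j).toReal * (Smax : ℝ) := by
          refine Finset.sum_le_sum fun j hj =>
            mul_le_mul_of_nonneg_left ?_ ENNReal.toReal_nonneg
          have := Finset.mem_range.1 hj
          exact_mod_cast (by omega : j - (z.1 + f z.2) ≤ Smax)
      _ = _ := by rw [← Finset.sum_mul, sum_service_eq_one hSmax, one_mul]
  have hUint : ∀ t, Integrable (fun ω => meanUnused f νS Smax (Q t ω, X t ω)) Pr := fun t =>
    Integrable.of_bound ((Measurable.of_discrete (f := meanUnused f νS Smax)).comp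
      (hq.measurable_state t)).aestronglyMeasurable Smax (Eventually.of_forall fun ω => by
        rw [Real.norm_of_nonneg (hU _).1]; exact (hU _).2)
  have hint : ∀ t (W : ℕ × E → ℂ) (C : ℝ), (∀ z, ‖W z‖ ≤ C) →
      Integrable (fun ω => W (Q t ω, X t ω)) Pr := fun t W C hW =>
    Integrable.of_bound ((Measurable.of_discrete (f := W)).comp
      (hq.measurable_state t)).aestronglyMeasurable C (Eventually.of_forall fun ω => hW _)
  have hu01 : ∀ t, u t ∈ Set.Icc (0 : ℝ) Smax := fun t => by
    refine ⟨integral_nonneg fun ω => (hU _).1, ?_⟩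
    calc u t ≤ ∫ _, (Smax : ℝ) ∂Pr :=
          integral_mono (hUint t) (integrable_const _) fun ω => (hU _).2
      _ = Smax := by simp
  have havg : ∀ n : ℕ, ((n : ℝ)⁻¹) * ∑ t ∈ Finset.range n, u t ∈ Set.Icc (0 : ℝ) Smax := by
    intro n
    refine ⟨mul_nonneg (by positivity) (Finset.sum_nonneg fun t _ => (hu01 t).1), ?_⟩
    rcases Nat.eq_zero_or_pos n with rfl | hn
    · simp
    · rw [inv_mul_le_iff₀ (by exact_mod_cast hn)]
      calc ∑ t ∈ Finset.range n, u t ≤ ∑ _t ∈ Finset.range n, (Smax : ℝ) :=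
            Finset.sum_le_sum fun t _ => (hu01 t).2
        _ = _ := by simp
  -- Unused service depends on the pair (Q, X), of which only the first component is known to
  -- converge, so compactness supplies a subsequential limit. The subsequence is chosen before `s`,
  -- so one `U` serves every `s`.
  obtain ⟨U, -, φ, hφ, hUlim⟩ := isCompact_Icc.tendsto_subseq havg
  have key : ∀ s : ℂ, ‖s‖ ≤ 1 → s.re ≤ 0 →
      ‖(∫ ω, Complex.exp (s * Qbar ω) ∂Pr') * (-(s * ε) + s ^ 2 * F) + s * U‖ ≤
        driftConst Amax Smax D * (‖s‖ ^ 3 + ‖s‖ ^ 2 * U) := by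
    intro s hs hs0
    have hVb := norm_testFun_le h3 h4 hs hs0
    refine norm_timeAverage_le (v := fun t => ∫ ω, testFun h k s (Q t ω, X t ω) ∂Pr)
      (B := 1 + 2 * D) hφ.tendsto_atTop (fun t => ?_) (tendsto_integral_exp_queue hQ hs0) hUlim fun t => ?_
    · exact (norm_integral_le_of_norm_le_const (Eventually.of_forall fun ω => hVb _)).trans_eq
        (by simp)
    · have hstepint : Integrable (fun ω => stepExpect P f νS Smax (testFun h k s)
          (Q t ω, X t ω)) Pr := by
        unfold stepExpect
        refine integrable_finsetSum _ fun j _ => integrable_finsetSum _ fun y _ => ?_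
        refine hint t (fun z => (((νS j).toReal * (P z.2 y).toReal : ℝ) : ℂ) *
          testFun h k s (nextQueue z.1 (f z.2) j, y)) ((νS j).toReal * 1 * (1 + 2 * D))
          fun z => ?_
        rw [norm_mul, Complex.norm_real, Real.norm_of_nonneg (by positivity)]
        gcongr
        · exact ENNReal.toReal_le_of_le_ofReal zero_le_one (by simpa using PMF.coe_le_one _ _)
        · exact hVb _
      have hVint := hint t _ _ hVb
      have hEint := hint t (fun z => Complex.exp (s * z.1)) 1
        fun z => norm_exp_mul_nat_le_one hs0 _
      have hUcint : Integrable (fun ω => (meanUnused f νS Smax (Q t ω, X t ω) : ℂ)) Pr :=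
        (hUint t).ofReal
      have e : (∫ ω, testFun h k s (Q (t + 1) ω, X (t + 1) ω) ∂Pr) -
          (∫ ω, testFun h k s (Q t ω, X t ω) ∂Pr) -
          (∫ ω, Complex.exp (s * Q t ω) ∂Pr) * (-(s * ε) + s ^ 2 * F) - s * u t =
          ∫ ω, (stepExpect P f νS Smax (testFun h k s) (Q t ω, X t ω) -
            testFun h k s (Q t ω, X t ω) - Complex.exp (s * Q t ω) * (-(s * ε) + s ^ 2 * F) -
            s * meanUnused f νS Smax (Q t ω, X t ω)) ∂Pr := by
        have I1 : Integrable (fun ω => stepExpect P f νS Smax (testFun h k s) (Q t ω, X t ω) -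
            testFun h k s (Q t ω, X t ω)) Pr := hstepint.sub hVint
        have I2 : Integrable (fun ω => Complex.exp (s * Q t ω) * (-(s * ε) + s ^ 2 * F)) Pr :=
          hEint.mul_const _
        have I3 : Integrable (fun ω => stepExpect P f νS Smax (testFun h k s) (Q t ω, X t ω) -
            testFun h k s (Q t ω, X t ω) - Complex.exp (s * Q t ω) * (-(s * ε) + s ^ 2 * F)) Pr :=
          I1.sub I2
        rw [integral_sub I3 (hUcint.const_mul s), integral_sub I1 I2, integral_sub hstepint hVint,
          integral_mul_const, integral_const_mul, hq.integral_state_succ hSmax t _ _ hVb,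
          integral_complex_ofReal]
      rw [e]
      refine (norm_integral_le_of_norm_le (g := fun ω => driftConst Amax Smax D * (‖s‖ ^ 3 +
        ‖s‖ ^ 2 * meanUnused f νS Smax (Q t ω, X t ω))) ?_ (Eventually.of_forall fun ω =>
          norm_drift_sub_le hSmax hμ hv hA hD h1 h2 h3 h4 hh hk hs hs0 _)).trans_eq ?_
      · exact ((integrable_const _).add ((hUint t).const_mul _)).const_mul _
      · rw [integral_const_mul, integral_add (integrable_const _) ((hUint t).const_mul _),
          integral_const_mul]
        simp [hu]
  have hUε := unused_eq_of_transform_bound hQbar_meas key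
  have := key s hs hs0
  rwa [hUε] at this

end Transform

/-! ### Uniform constants and the limit as `ε` tends to zero -/

/-- A bound, uniform in the modulating chain, for the coefficients of the test function. -/
noncomputable def correctionBound (Amax : ℕ) (μ v C α : ℝ) : ℝ :=
  let H := 2 * Amax * (C + 1) / (1 - α)
  let B := ((Amax + μ) ^ 2 + v) / 2 + (Amax + μ) * H
  (Amax + μ) + ((Amax + μ) ^ 2 + v) / 2 + H + 2 * B * (C + 1) / (1 - α)

lemma correctionBound_nonneg (Amax : ℕ) {μ v C α : ℝ} (hμ : 0 ≤ μ) (hv : 0 ≤ v) (hC : 0 ≤ C)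
    (hα : α < 1) : 0 ≤ correctionBound Amax μ v C α := by
  have : 0 < 1 - α := sub_pos.2 hα
  unfold correctionBound
  positivity

lemma norm_transform_sub_le {Ω E Ω' : Type*} [MeasurableSpace Ω] [MeasurableSpace E]
    [MeasurableSpace Ω'] [Fintype E] [DiscreteMeasurableSpace E] {Pr : Measure Ω}
    [IsProbabilityMeasure Pr] {Pr' : Measure Ω'} [IsProbabilityMeasure Pr'] {Qbar : Ω' → ℕ}
    {P : E → PMF E} {f : E → ℕ} {π : PMF E} {νS : PMF ℕ} {X : ℕ → Ω → E} {S Q : ℕ → Ω → ℕ}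
    (hq : IsMarkovModulatedQueue Pr P f νS X S Q) (hπ : IsStationary P π) {Smax Amax : ℕ}
    {μ v ε C α : ℝ} (hSmax : ∀ s ∈ νS.support, s ≤ Smax)
    (hμ : ∫ s, (s : ℝ) ∂νS.toMeasure = μ)
    (hv : variance (fun s : ℕ => (s : ℝ)) νS.toMeasure = v) (hA : ∀ x, f x ≤ Amax)
    (hrate : expect π (fun x => (f x : ℝ)) = μ - ε)
    (hC : 0 ≤ C) (hα0 : 0 ≤ α) (hα1 : α < 1)
    (hmix : ∀ m : ℕ, 1 ≤ m → ∀ x, tvDist (nStep P m x) π ≤ C * α ^ m)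
    (hQbar_meas : Measurable Qbar) (hQ : TendstoInDistribution Q atTop Qbar (fun _ => Pr) Pr')
    {s : ℂ} (hs : ‖s‖ ≤ 1) (hs0 : s.re ≤ 0) :
    ‖(∫ ω, Complex.exp (s * Qbar ω) ∂Pr') * (-(s * ε) + s ^ 2 *
        (((autocov P π f 0 + 2 * ∑' t, autocov P π f (t + 1) + ε ^ 2 + v) / 2 : ℝ) : ℂ)) +
        s * ε‖ ≤
      driftConst Amax Smax (correctionBound Amax μ v C α) * (‖s‖ ^ 3 + ‖s‖ ^ 2 * ε) := by
  have hμ0 : 0 ≤ μ := hμ ▸ integral_nonneg fun s => Nat.cast_nonneg _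
  have hv0 : 0 ≤ v := hv ▸ variance_nonneg _ _
  have hα : 0 < 1 - α := sub_pos.2 hα1
  have hfA : ∀ x, |(f x : ℝ)| ≤ Amax := fun x => by
    rw [abs_of_nonneg (Nat.cast_nonneg _)]; exact_mod_cast hA x
  have hfμ : ∀ x, |(f x : ℝ) - μ| ≤ Amax + μ := fun x =>
    (abs_sub _ _).trans (add_le_add (hfA x) (abs_of_nonneg hμ0).le)
  have hd := geometricDecay_of_tvDist_le (π := π) hC hmix hα0 hfA
  set H : ℝ := 2 * Amax * (C + 1) / (1 - α) with hH
  have hH0 : 0 ≤ H := by positivity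
  set h : E → ℝ := poisson P π fun x => (f x : ℝ) with hh
  have hhH : ∀ x, |h x| ≤ H := fun x => abs_poisson_le hd hα0 hα1 x
  have hquad : ∀ x, |(((f x : ℝ) - μ) ^ 2 + v) / 2| ≤ ((Amax + μ) ^ 2 + v) / 2 := fun x => by
    rw [abs_of_nonneg (by positivity)]
    have := pow_le_pow_left₀ (abs_nonneg _) (hfμ x) 2
    rw [sq_abs] at this
    linarith
  -- `B` bounds the second-order coefficient `F`, so the mixing estimate applies a second time, now
  -- to `F`, and bounds its Poisson solution.
  set B : ℝ := ((Amax + μ) ^ 2 + v) / 2 + (Amax + μ) * H with hB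
  have hB0 : 0 ≤ B := by positivity
  set F : E → ℝ := fun x => (((f x : ℝ) - μ) ^ 2 + v) / 2 +
      ((f x : ℝ) - μ) * expect (P x) h with hF
  have hFB : ∀ x, |F x| ≤ B := fun x => by
    refine (abs_add_le _ _).trans (add_le_add (hquad x) ?_)
    rw [abs_mul]
    exact mul_le_mul (hfμ x) (abs_expect_le _ hhH) (abs_nonneg _) (by positivity)
  have hd2 := geometricDecay_of_tvDist_le (π := π) hC hmix hα0 hFB
  have hkb : ∀ x, |poisson P π F x| ≤ 2 * B * (C + 1) / (1 - α) := fun x =>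
    abs_poisson_le hd2 hα0 hα1 x
  have hk0 : 0 ≤ 2 * B * (C + 1) / (1 - α) := by positivity
  have hA0 : (0 : ℝ) ≤ Amax + μ := by positivity
  have hq0 : 0 ≤ ((Amax + μ) ^ 2 + v) / 2 := by positivity
  have hDe : correctionBound Amax μ v C α =
    (Amax + μ) + ((Amax + μ) ^ 2 + v) / 2 + H + 2 * B * (C + 1) / (1 - α) := rfl
  rw [← expect_quadratic_drift hd hα0 hα1 hπ hrate]
  refine norm_transform_equation_le (h := h) (k := poisson P π F) hq hSmax hμ hv hA
    (correctionBound_nonneg Amax hμ0 hv0 hC hα1) (fun x => (hfμ x).trans ?_)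
    (fun x => (hquad x).trans ?_) (fun x => (hhH x).trans ?_) (fun x => (hkb x).trans ?_)
    (fun x => ?_) (fun x => ?_) hQbar_meas hQ hs hs0
  · rw [hDe]; linarith
  · rw [hDe]; linarith
  · rw [hDe]; linarith
  · rw [hDe]; linarith
  · rw [hh, expect_poisson hd hα0 hα1, hrate]; ring
  · exact expect_poisson hd2 hα0 hα1 x

lemma one_sub_mul_ofReal_ne_zero {z : ℂ} (hz : z.re ≤ 0) {m : ℝ} (hm : 0 ≤ m) :
    1 - z * m ≠ 0 := by
  intro h
  have h' := congrArg Complex.re h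
  rw [Complex.sub_re, Complex.one_re, Complex.re_mul_ofReal, Complex.zero_re] at h'
  nlinarith [mul_nonneg (neg_nonneg.2 hz) hm]

/-- At `s = ε z` the equation has size `ε ^ 2`, while its error is of order `ε ^ 3`. The limit
equation ψ (1 − z m) = 1 is solvable because 1 − z m does not vanish on the closed left half-plane.
-/
lemma tendsto_of_transform_bound {ψ : ℝ → ℂ → ℂ} {F : ℝ → ℝ} {K m : ℝ} (hm : 0 ≤ m)
    (hF : Tendsto F (𝓝[>] 0) (𝓝 m)) (hψ0 : ∀ ε, ψ ε 0 = 1)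
    (h : ∀ᶠ ε in 𝓝[>] (0 : ℝ), ∀ s : ℂ, ‖s‖ ≤ 1 → s.re ≤ 0 →
      ‖ψ ε s * (-(s * ε) + s ^ 2 * F ε) + s * ε‖ ≤ K * (‖s‖ ^ 3 + ‖s‖ ^ 2 * ε))
    {z : ℂ} (hz : z.re ≤ 0) :
    Tendsto (fun ε => ψ ε (ε * z)) (𝓝[>] 0) (𝓝 (1 / (1 - z * m))) := by
  -- The estimate is divided by `‖z‖` below, so `z = 0` is settled by `hψ0`.
  rcases eq_or_ne z 0 with rfl | hz0
  · simp [hψ0]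
  have hne := one_sub_mul_ofReal_ne_zero hz hm
  have hid : Tendsto (fun ε : ℝ => ε) (𝓝[>] 0) (𝓝 0) := tendsto_nhdsWithin_of_tendsto_nhds
    tendsto_id
  have hFc : Tendsto (fun ε => 1 - z * (F ε : ℂ)) (𝓝[>] 0) (𝓝 (1 - z * m)) :=
    (((Complex.continuous_ofReal.tendsto m).comp hF).const_mul z).const_sub 1
  have hzn : 0 < ‖z‖ := norm_pos_iff.2 hz0
  have hsmall : ∀ᶠ ε in 𝓝[>] (0 : ℝ), ε * ‖z‖ < 1 := by
    have := hid.mul_const ‖z‖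
    rw [zero_mul] at this
    exact this.eventually_lt_const zero_lt_one
  have hprod : Tendsto (fun ε => ψ ε (ε * z) * (1 - z * F ε)) (𝓝[>] 0) (𝓝 1) := by
    rw [tendsto_iff_norm_sub_tendsto_zero]
    have hb : Tendsto (fun ε : ℝ => K * (ε * (‖z‖ ^ 2 + ‖z‖))) (𝓝[>] 0) (𝓝 0) := by
      simpa using (hid.mul_const (‖z‖ ^ 2 + ‖z‖)).const_mul K
    refine squeeze_zero' (Eventually.of_forall fun _ => norm_nonneg _) ?_ hb
    filter_upwards [h, hsmall, self_mem_nhdsWithin] with ε hε hε1 hε0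
    have hε0' : 0 < ε := hε0
    have hn : ‖(ε : ℂ) * z‖ = ε * ‖z‖ := by
      rw [norm_mul, Complex.norm_real, Real.norm_of_nonneg hε0'.le]
    have hb := hε (ε * z) (by rw [hn]; exact hε1.le) (by
      rw [Complex.re_ofReal_mul]; exact mul_nonpos_of_nonneg_of_nonpos hε0'.le hz)
    have e : ψ ε (ε * z) * (-(ε * z * ε) + (ε * z) ^ 2 * F ε) + ε * z * ε =
        -((ε : ℂ) * z * ε) * (ψ ε (ε * z) * (1 - z * F ε) - 1) := by ring
    rw [e, norm_mul, norm_neg, norm_mul, hn, Complex.norm_real, Real.norm_of_nonneg hε0'.le] at hb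
    have hp : 0 < ε * ‖z‖ * ε := by positivity
    refine le_of_mul_le_mul_left (hb.trans_eq ?_) hp
    ring
  have hdiv := hprod.div hFc hne
  refine hdiv.congr' ?_
  filter_upwards [hFc.eventually_ne hne] with ε hε
  exact mul_div_cancel_right₀ _ hε

/-! ### Characteristic function of the exponential law -/

lemma charFun_expMeasure {r : ℝ} (hr : 0 < r) (t : ℝ) :
    charFun (expMeasure r) t = r / (r - t * Complex.I) := by
  have hpdf : Measurable (gammaPDF 1 r) := (measurable_gammaPDFReal 1 r).ennreal_ofReal
  rw [charFun_apply_real, expMeasure, gammaMeasure,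
    integral_withDensity_eq_integral_toReal_smul hpdf
      (Eventually.of_forall fun x => ENNReal.ofReal_lt_top)]
  have e : ∀ x : ℝ, (gammaPDF 1 r x).toReal • Complex.exp (t * x * Complex.I) =
      (Set.Ici (0 : ℝ)).indicator
        (fun x : ℝ => (r : ℂ) * Complex.exp ((t * Complex.I - r) * x)) x := by
    intro x
    by_cases hx : 0 ≤ x
    · rw [Set.indicator_of_mem (Set.mem_Ici.2 hx), gammaPDF_of_nonneg hx,
        ENNReal.toReal_ofReal (by simp; positivity)]
      simp only [Real.rpow_one, Real.Gamma_one, div_one, sub_self, Real.rpow_zero, mul_one,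
        Complex.real_smul]
      push_cast
      rw [mul_assoc, ← Complex.exp_add]
      congr 2; ring
    · rw [Set.indicator_of_notMem (by simpa using hx), gammaPDF_of_neg (not_le.1 hx)]
      simp
  simp only [e]
  rw [integral_indicator measurableSet_Ici, integral_Ici_eq_integral_Ioi, integral_const_mul,
    integral_exp_mul_complex_Ioi (by simpa using hr)]
  have hne : (t * Complex.I - r : ℂ) ≠ 0 := fun h => by
    have := congrArg Complex.re h
    simp at this
    exact hr.ne' this
  have hne' : (r - t * Complex.I : ℂ) ≠ 0 := fun h => hne (by linear_combination -h)
  simp only [Complex.ofReal_zero, mul_zero, Complex.exp_zero]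
  field_simp
  ring

lemma charFun_expLaw {m : ℝ} (hm : 0 ≤ m) (t : ℝ) :
    charFun (expLaw m) t = 1 / (1 - t * Complex.I * m) := by
  unfold expLaw
  split_ifs with h
  · rw [charFun_expMeasure (one_div_pos.2 h)]
    have hm0 : (m : ℂ) ≠ 0 := by exact_mod_cast h.ne'
    have h1 := one_sub_mul_ofReal_ne_zero (z := t * Complex.I) (by simp) hm
    push_cast
    have e : (1 / (m : ℂ) - t * Complex.I) = (1 - t * Complex.I * m) / m := by
      field_simp
    rw [e, div_div_div_cancel_right₀ hm0]
  · obtain rfl : m = 0 := le_antisymm (not_lt.1 h) hm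
    simp

/-! ### Passing to the limit in the autocovariances and in distribution -/

/-- Convergence of the autocovariance series for a family of uniformly mixing chains. -/
lemma exists_sq_tendsto_autocov {E : ℝ → Type*} [∀ ε, Fintype (E ε)]
    {P : (ε : ℝ) → E ε → PMF (E ε)} {f : (ε : ℝ) → E ε → ℕ} {π : (ε : ℝ) → PMF (E ε)}
    {D α : ℝ} (hα0 : 0 ≤ α) (hα1 : α < 1)
    (hd : ∀ᶠ ε in 𝓝[>] (0 : ℝ), GeometricDecay (P ε) (π ε) (fun x => (f ε x : ℝ)) D α)
    (hπ : ∀ᶠ ε in 𝓝[>] (0 : ℝ), IsStationary (P ε) (π ε)) {γ : ℕ → ℝ}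
    (hγ : ∀ t, Tendsto (fun ε => autocov (P ε) (π ε) (f ε) t) (𝓝[>] 0) (𝓝 (γ t))) :
    ∃ σa : ℝ, Tendsto (fun m : ℕ => γ 0 + 2 * ∑ t ∈ Finset.Icc 1 m, γ t) atTop (𝓝 (σa ^ 2)) ∧
      Tendsto (fun ε => autocov (P ε) (π ε) (f ε) 0 + 2 * ∑' t, autocov (P ε) (π ε) (f ε) (t + 1))
        (𝓝[>] 0) (𝓝 (σa ^ 2)) := by
  have hbsum : Summable fun t : ℕ => D * (D * α ^ (t + 1)) :=
    (((summable_nat_add_iff 1).2 (summable_geometric_of_lt_one hα0 hα1)).mul_left D).mul_left D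
  have hbound : ∀ t, ‖γ (t + 1)‖ ≤ D * (D * α ^ (t + 1)) := fun t =>
    le_of_tendsto (hγ (t + 1)).norm (hd.mono fun ε hε => abs_autocov_le hε (t + 1))
  have hsum : Summable fun t => γ (t + 1) := Summable.of_norm_bounded hbsum hbound
  have hlim : Tendsto (fun ε => ∑' t, autocov (P ε) (π ε) (f ε) (t + 1)) (𝓝[>] 0)
      -- The geometric bound does not depend on `ε`, so limit and series may be exchanged.
      (𝓝 (∑' t, γ (t + 1))) :=
    tendsto_tsum_of_dominated_convergence hbsum (fun t => hγ (t + 1))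
      (hd.mono fun ε hε t => abs_autocov_le hε (t + 1))
  have hV := (hγ 0).add (hlim.const_mul 2)
  have hnn : 0 ≤ γ 0 + 2 * ∑' t, γ (t + 1) := by
    refine ge_of_tendsto hV ?_
    filter_upwards [hd, hπ] with ε h1 h2
    exact autocov_zero_add_tsum_nonneg h1 hα0 hα1 h2
  refine ⟨√(γ 0 + 2 * ∑' t, γ (t + 1)), ?_, ?_⟩
  · rw [Real.sq_sqrt hnn]
    have e : ∀ m : ℕ, ∑ t ∈ Finset.Icc 1 m, γ t = ∑ t ∈ Finset.range m, γ (t + 1) := fun m => by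
      rw [Finset.range_eq_Ico, Finset.sum_Ico_add' γ 0 m 1]
      rfl
    simp only [e]
    exact (hsum.hasSum.tendsto_sum_nat.const_mul 2).const_add _
  · rw [Real.sq_sqrt hnn]
    exact hV

/-- Convergence in distribution to the exponential law from convergence of the transforms on the
imaginary axis. -/
lemma tendstoInDistribution_expLaw {Ω' : ℝ → Type*} [∀ ε, MeasurableSpace (Ω' ε)]
    {Pr' : (ε : ℝ) → Measure (Ω' ε)} [∀ ε, IsProbabilityMeasure (Pr' ε)]
    {Qbar : (ε : ℝ) → Ω' ε → ℕ} (hQ : ∀ ε, Measurable (Qbar ε)) {m : ℝ} (hm : 0 ≤ m)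
    (h : ∀ t : ℝ, Tendsto (fun ε : ℝ =>
      ∫ ω, Complex.exp (ε * (t * Complex.I) * Qbar ε ω) ∂Pr' ε) (𝓝[>] 0)
        (𝓝 (1 / (1 - t * Complex.I * m)))) :
    TendstoInDistribution (fun ε ω => ε * (Qbar ε ω : ℝ)) (𝓝[>] 0) (fun y : ℝ => y) Pr'
      (expLaw m) := by
  have hmeas : ∀ ε, Measurable fun ω => ε * (Qbar ε ω : ℝ) := fun ε =>
    (Measurable.of_discrete (f := fun q : ℕ => ε * (q : ℝ))).comp (hQ ε)
  refine ⟨fun ε => (hmeas ε).aemeasurable, aemeasurable_id', ?_⟩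
  -- The right neighbourhood filter of zero is countably generated, so Lévy's continuity theorem can
  -- be applied along sequences.
  refine tendsto_of_seq_tendsto fun x hx => ?_
  refine ProbabilityMeasure.tendsto_of_tendsto_charFun fun t => ?_
  have e1 : (Measure.map (fun y : ℝ => y) (expLaw m)) = expLaw m := Measure.map_id
  have e2 : ∀ ε, charFun (Measure.map (fun ω => ε * (Qbar ε ω : ℝ)) (Pr' ε)) t =
      ∫ ω, Complex.exp (ε * (t * Complex.I) * Qbar ε ω) ∂Pr' ε := fun ε => by
    rw [charFun_apply_real, integral_map (hmeas ε).aemeasurable (by fun_prop)]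
    refine integral_congr_ae (Eventually.of_forall fun ω => ?_)
    simp only
    push_cast
    congr 1; ring
  have := (h t).comp hx
  rw [← charFun_expLaw hm] at this
  simp only [ProbabilityMeasure.coe_mk, e1]
  exact this.congr fun n => (e2 (x n)).symm

end HeavyTraffic

/-! ### The heavy-traffic theorem -/

theorem mainTheorem4
    -- service distribution: bounded, mean `μ`, variance `σs ^ 2`
    (νS : PMF ℕ) (Smax : ℕ) (hSmax : ∀ s ∈ νS.support, s ≤ Smax)
    (μ σs : ℝ) (hμ_pos : 0 < μ)
    (hμ : ∫ s, (s : ℝ) ∂νS.toMeasure = μ)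
    (hσs : variance (fun s : ℕ => (s : ℝ)) νS.toMeasure = σs ^ 2)
    -- the modulating finite-state chains and their stationary distributions, indexed by `ε`
    (E : ℝ → Type*) [∀ ε, Fintype (E ε)] [∀ ε, MeasurableSpace (E ε)]
    [∀ ε, DiscreteMeasurableSpace (E ε)]
    (P : (ε : ℝ) → E ε → PMF (E ε)) (f : (ε : ℝ) → E ε → ℕ) (π : (ε : ℝ) → PMF (E ε))
    (hP_irred : ∀ ε ∈ Set.Ioo 0 μ, HeavyTraffic.IsIrreducibleOn (P ε) Set.univ)
    (hP_aper : ∀ ε ∈ Set.Ioo 0 μ, HeavyTraffic.IsAperiodicOn (P ε) Set.univ)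
    (hπ : ∀ ε ∈ Set.Ioo 0 μ, HeavyTraffic.IsStationary (P ε) (π ε))
    (Amax : ℕ) (hAmax : ∀ ε ∈ Set.Ioo 0 μ, ∀ x, f ε x ≤ Amax)
    (hrate : ∀ ε ∈ Set.Ioo 0 μ, HeavyTraffic.expect (π ε) (fun x => (f ε x : ℝ)) = μ - ε)
    -- geometric mixing with parameters bounded uniformly in `ε`
    (αε Cε : ℝ → ℝ) (α C : ℝ)
    (hα_mem : ∀ ε ∈ Set.Ioo 0 μ, αε ε ∈ Set.Ioo (0 : ℝ) 1)
    (hC_pos : ∀ ε ∈ Set.Ioo 0 μ, 0 < Cε ε)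
    (hmix : ∀ ε ∈ Set.Ioo 0 μ, ∀ m : ℕ, 1 ≤ m → ∀ x,
      HeavyTraffic.tvDist (HeavyTraffic.nStep (P ε) m x) (π ε) ≤ Cε ε * αε ε ^ m)
    (hα_lt : α < 1) (hα_sup : ∀ ε ∈ Set.Ioo 0 μ, αε ε ≤ α)
    (hC_sup : ∀ ε ∈ Set.Ioo 0 μ, Cε ε ≤ C)
    -- convergence of the autocovariances
    (γ : ℕ → ℝ)
    (hγ : ∀ t, Tendsto (fun ε => HeavyTraffic.autocov (P ε) (π ε) (f ε) t) (𝓝[>] 0) (𝓝 (γ t)))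
    -- the queueing processes
    (Ω : ℝ → Type*) [∀ ε, MeasurableSpace (Ω ε)]
    (Pr : (ε : ℝ) → Measure (Ω ε)) [∀ ε, IsProbabilityMeasure (Pr ε)]
    (X : (ε : ℝ) → ℕ → Ω ε → E ε) (S Q : (ε : ℝ) → ℕ → Ω ε → ℕ)
    (hqueue : ∀ ε ∈ Set.Ioo 0 μ,
      HeavyTraffic.IsMarkovModulatedQueue (Pr ε) (P ε) (f ε) νS (X ε) (S ε) (Q ε))
    -- the two-dimensional chain lives on a state space on which it is irreducible and aperiodic
    (St : (ε : ℝ) → Set (ℕ × E ε))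
    (hSt_start : ∀ ε ∈ Set.Ioo 0 μ, ∀ᵐ ω ∂Pr ε, (Q ε 0 ω, X ε 0 ω) ∈ St ε)
    (hSt_irred : ∀ ε ∈ Set.Ioo 0 μ,
      HeavyTraffic.IsIrreducibleOn (HeavyTraffic.queueStep (P ε) (f ε) νS) (St ε))
    (hSt_aper : ∀ ε ∈ Set.Ioo 0 μ,
      HeavyTraffic.IsAperiodicOn (HeavyTraffic.queueStep (P ε) (f ε) νS) (St ε))
    -- the steady-state queue length, the limit in distribution of `Q^t` as `t → ∞`
    (Ω' : ℝ → Type*) [∀ ε, MeasurableSpace (Ω' ε)]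
    (Pr' : (ε : ℝ) → Measure (Ω' ε)) [∀ ε, IsProbabilityMeasure (Pr' ε)]
    (Qbar : (ε : ℝ) → Ω' ε → ℕ) (hQbar_meas : ∀ ε, Measurable (Qbar ε))
    (hQbar : ∀ ε ∈ Set.Ioo 0 μ,
      TendstoInDistribution (Q ε) atTop (Qbar ε) (fun _ => Pr ε) (Pr' ε)) :
    ∃ σa : ℝ,
      Tendsto (fun m : ℕ => γ 0 + 2 * ∑ t ∈ Finset.Icc 1 m, γ t) atTop (𝓝 (σa ^ 2)) ∧
      (∀ θ : ℝ, θ ≤ 0 →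
        Tendsto (fun ε => ∫ ω, Real.exp (ε * θ * (Qbar ε ω : ℝ)) ∂Pr' ε) (𝓝[>] 0)
          (𝓝 (1 / (1 - θ * ((σa ^ 2 + σs ^ 2) / 2))))) ∧
      TendstoInDistribution (fun ε ω => ε * (Qbar ε ω : ℝ)) (𝓝[>] 0) (fun y : ℝ => y) Pr'
        (HeavyTraffic.expLaw ((σa ^ 2 + σs ^ 2) / 2)) := by
  obtain ⟨ε₀, hε₀⟩ : (Set.Ioo 0 μ).Nonempty := Set.nonempty_Ioo.2 hμ_pos
  have hα0 : 0 ≤ α := (hα_mem ε₀ hε₀).1.le.trans (hα_sup ε₀ hε₀)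
  have hC0 : 0 ≤ C := (hC_pos ε₀ hε₀).le.trans (hC_sup ε₀ hε₀)
  have hev : ∀ᶠ ε in 𝓝[>] (0 : ℝ), ε ∈ Set.Ioo 0 μ := Ioo_mem_nhdsGT hμ_pos
  -- Replacing the parameters of each chain by the common `C` and `α` makes every later constant
  -- independent of `ε`.
  have hmix' : ∀ ε ∈ Set.Ioo 0 μ, ∀ m : ℕ, 1 ≤ m → ∀ x,
      HeavyTraffic.tvDist (HeavyTraffic.nStep (P ε) m x) (π ε) ≤ C * α ^ m :=
    fun ε hε m hm x => (hmix ε hε m hm x).trans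
      (mul_le_mul (hC_sup ε hε) (pow_le_pow_left₀ (hα_mem ε hε).1.le (hα_sup ε hε) m)
        (pow_nonneg (hα_mem ε hε).1.le m) hC0)
  obtain ⟨σa, hσa, hlim⟩ := HeavyTraffic.exists_sq_tendsto_autocov (D := 2 * Amax * (C + 1))
    hα0 hα_lt
    (hev.mono fun ε hε => HeavyTraffic.geometricDecay_of_tvDist_le hC0 (hmix' ε hε) hα0 fun x => by
      rw [abs_of_nonneg (Nat.cast_nonneg _)]
      exact_mod_cast hAmax ε hε x)
    (hev.mono hπ) hγ
  have hm : 0 ≤ (σa ^ 2 + σs ^ 2) / 2 := by positivity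
  have hid : Tendsto (fun ε : ℝ => ε) (𝓝[>] 0) (𝓝 0) :=
    tendsto_nhdsWithin_of_tendsto_nhds tendsto_id
  have hF : Tendsto (fun ε => (HeavyTraffic.autocov (P ε) (π ε) (f ε) 0 +
      2 * ∑' t, HeavyTraffic.autocov (P ε) (π ε) (f ε) (t + 1) + ε ^ 2 + σs ^ 2) / 2) (𝓝[>] 0)
      (𝓝 ((σa ^ 2 + σs ^ 2) / 2)) := by
    simpa using ((hlim.add (hid.pow 2)).add_const (σs ^ 2)).div_const 2
  -- The half-plane contains both the nonpositive reals, for the stated transform, and the imaginary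
  -- axis, for the characteristic functions.
  have key : ∀ z : ℂ, z.re ≤ 0 → Tendsto (fun ε : ℝ =>
      ∫ ω, Complex.exp (ε * z * Qbar ε ω) ∂Pr' ε) (𝓝[>] 0)
        (𝓝 (1 / (1 - z * (((σa ^ 2 + σs ^ 2) / 2 : ℝ) : ℂ)))) := fun z hz =>
    HeavyTraffic.tendsto_of_transform_bound
      (ψ := fun ε s => ∫ ω, Complex.exp (s * Qbar ε ω) ∂Pr' ε) hm hF (by simp)
      (hev.mono fun ε hε s hs hs0 => HeavyTraffic.norm_transform_sub_le (hqueue ε hε) (hπ ε hε)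
        hSmax hμ hσs (hAmax ε hε) (hrate ε hε) hC0 hα0 hα_lt (hmix' ε hε) (hQbar_meas ε)
        (hQbar ε hε) hs hs0) hz
  refine ⟨σa, hσa, fun θ hθ => ?_, ?_⟩
  · have h := key θ (by simpa using hθ)
    have e : ∀ ε : ℝ, ∫ ω, Complex.exp (ε * θ * Qbar ε ω) ∂Pr' ε =
        ((∫ ω, Real.exp (ε * θ * (Qbar ε ω : ℝ)) ∂Pr' ε : ℝ) : ℂ) := fun ε => by
      rw [← integral_complex_ofReal]
      push_cast
      rfl
    have h' := (Complex.continuous_re.tendsto _).comp h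
    have e' : (1 / (1 - (θ : ℂ) * (((σa ^ 2 + σs ^ 2) / 2 : ℝ) : ℂ))) =
        ((1 / (1 - θ * ((σa ^ 2 + σs ^ 2) / 2)) : ℝ) : ℂ) := by push_cast; rfl
    simp only [Function.comp_def, e] at h'
    rw [e'] at h'
    simpa only [Complex.ofReal_re] using h'
  · exact HeavyTraffic.tendstoInDistribution_expLaw hQbar_meas hm fun t =>
      key (t * Complex.I) (by simp)
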